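/- Fix real numbers $c\ge 0$ and $p>0$. For an integer $n\ge p$, $n \geq 1$, let $A_n$ be the adjacency matrix of an Erdős–Rényi random graph $G\sim \mathrm{G}(n,p/n)$ on $\{1,\dots,n\}$ (each pair of vertices is joined by an edge with probability $p/n$, independently of the other pairs). Let $D_n$ be the diagonal matrix whose $i$th diagonal entry is $c+d_i$ if the degree $d_i$ of vertex $i$ in $G$ is positive, and $1$ if $d_i=0$. Put $K_n=D_n^{-1}A_n$. All eigenvalues $\lambda_1(K_n),\dots,\lambda_n(K_n)$ (counted with multiplicity) are real; let $\mathrm{esd}(K_n)=n^{-1}\sum_{i=1}^n\delta_{\lambda_i(K_n)}$ be the empirical spectral distribution of $K_n$. Then, as $n\to\infty$, $\mathrm{esd}(K_n)$ converges weakly in probability to a (unique, deterministic) probability distribution $\mathrm{esd}_\infty$ on $\mathbb{R}$, and its essential supremum is $$\operatorname{ess\,sup}\,\mathrm{esd}_\infty:=\sup\{x\in\mathbb{R}:\ \mathrm{esd}_\infty((x,\infty))>0\}=\tau_c:=\frac{1}{\sqrt{1+c}}.$$ Here weak convergence in probability means that $\int f\,d\,\mathrm{esd}(K_n)\to\int f\,d\,\mathrm{esd}_\infty$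 in probability for every bounded continuous $f:\mathbb{R}\to\mathbb{R}$. -/

import Mathlib

open MeasureTheory ProbabilityTheory Filter Topology
open scoped BoundedContinuousFunction ENNReal

/-- The value `τ_c = 1 / √(1 + c)`. -/
noncomputable def tau (c : ℝ) : ℝ := 1 / Real.sqrt (1 + c)

/-- The diagonal entries of `D`: the entry of a vertex `v` is `c + deg v`, except that it is `1` if
`v` is isolated. For `c ≥ 0` all these entries are positive. -/
noncomputable def diagWeight {V : Type*} [Fintype V] (c : ℝ) (G : SimpleGraph V) (v : V) : ℝ := by
  classical exact if G.degree v = 0 then 1 else c + (G.degree v : ℝ)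

/-- The matrix `K_G(c) = D⁻¹ A_G`, where `A_G` is the adjacency matrix of `G`. -/
noncomputable def kMatrix {V : Type*} [Fintype V] [DecidableEq V] (c : ℝ) (G : SimpleGraph V) :
    Matrix V V ℝ := by
  classical exact Matrix.diagonal (fun v => (diagWeight c G v)⁻¹) * G.adjMatrix ℝ

/-- The empirical spectral distribution `n⁻¹ ∑ᵢ δ_{λᵢ(M)}` of an `n × n` real matrix all of whose
eigenvalues `λᵢ(M)` are real; they are counted with (algebraic) multiplicity, that is, as roots of
the characteristic polynomial. -/
noncomputable def esd {V : Type*} [Fintype V] [DecidableEq V] (M : Matrix V V ℝ) : Measure ℝ :=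
  (Fintype.card V : ℝ≥0∞)⁻¹ • (M.charpoly.roots.map (fun x : ℝ => Measure.dirac x)).sum

theorem diagWeight_pos {V : Type*} [Fintype V] {c : ℝ} (hc : 0 ≤ c) (G : SimpleGraph V) (v : V) :
    0 < diagWeight c G v := by
  classical
  unfold diagWeight
  split_ifs with h
  · exact one_pos
  · have : (0 : ℝ) < G.degree v := by exact_mod_cast Nat.pos_of_ne_zero h
    linarith

/-- All the eigenvalues of `K_G(c)` are real, so that `esd (kMatrix c G)` counts each of them. -/
theorem splits_charpoly_kMatrix {V : Type*} [Fintype V] [DecidableEq V] {c : ℝ} (hc : 0 ≤ c)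
    (G : SimpleGraph V) : (kMatrix c G).charpoly.Splits := by
  classical
  set S : Matrix V V ℝ := Matrix.diagonal (fun v => Real.sqrt (diagWeight c G v)⁻¹) with hS
  have h1 : kMatrix c G = S * (S * G.adjMatrix ℝ) := by
    rw [← Matrix.mul_assoc, hS, Matrix.diagonal_mul_diagonal]
    unfold kMatrix
    congr 2
    · ext v
      exact (Real.mul_self_sqrt (inv_nonneg.2 (diagWeight_pos hc G v).le)).symm
  rw [h1, Matrix.charpoly_mul_comm]
  apply Matrix.IsHermitian.splits_charpoly (𝕜 := ℝ)
  rw [Matrix.IsHermitian, Matrix.conjTranspose_eq_transpose_of_trivial, Matrix.transpose_mul,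
    Matrix.transpose_mul, SimpleGraph.transpose_adjMatrix, hS, Matrix.diagonal_transpose,
    Matrix.mul_assoc]

/-- The edge probability `p / n`, as an element of the unit interval (it is truncated to `1` for
the finitely many `n` with `p / n > 1`). -/
noncomputable def edgeProb (p : ℝ) (n : ℕ) : unitInterval :=
  Set.projIcc (0 : ℝ) 1 zero_le_one (p / n)

/-- `ν` is the limiting empirical spectral distribution of `K_n = K_{G_n}(c)` with
`G_n ∼ G(n, p/n)`: the random measures `esd K_n` converge to `ν` weakly in probability, i.e.
`∫ f d(esd K_n) → ∫ f dν` in probability as `n → ∞`, for every bounded continuous `f`. -/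
def IsLimitingESD (c p : ℝ) (ν : ProbabilityMeasure ℝ) : Prop :=
  ∀ f : ℝ →ᵇ ℝ, ∀ ε : ℝ, 0 < ε →
    Tendsto (fun n : ℕ => SimpleGraph.binomialRandom (Fin n) (edgeProb p n)
      {G : SimpleGraph (Fin n) |
        ε ≤ |(∫ x, f x ∂(esd (kMatrix c G))) - ∫ x, f x ∂(ν : Measure ℝ)|}) atTop (𝓝 0)

/-- `s` is the essential supremum `sup {x : ν (x, ∞) > 0}` of the measure `ν` on `ℝ`. -/
def IsEssSup (ν : Measure ℝ) (s : ℝ) : Prop := IsLUB {x : ℝ | 0 < ν (Set.Ioi x)} s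

/-!
The empirical spectral distribution of `K = D⁻¹ A` is studied through its moments, the normalized
traces `n⁻¹ tr K ^ k`. All spectra lie in `[-1, 1]`, since `K` is similar to a symmetric matrix and
its powers have entries in `[0, 1]`; so convergence of moments is equivalent to weak convergence.

*Concentration.* Adding an edge to a graph changes two rows of `K`, hence each trace of a power by a
bounded amount (`abs_trace_kMatrix_pow_sub_le`). As each of the `O(n²)` pairs is independently an edge
with probability `p / n`, the Efron–Stein inequality (`bernoulliMean_variance_le`) bounds the variance of
`n⁻¹ tr K ^ k` by `O(1 / n)`.

*Convergence of the means.* The trace of `K ^ k` is a sum over closed walks. Grouping the walks by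
the pattern of coincidences among their vertices (`sum_eq_sum_setoid`), one has to place a fixed
connected graph `H` in the random graph, weighted by a function of the degrees at the placement. Up
to an error of order `1 / n`, these degrees are the degrees in `H` plus independent binomial
variables (`abs_graphMean_placement_sub_le`), which become Poisson in the limit. Since there are
about `n ^ |V(H)|` placements, each present with probability `(p / n) ^ |E(H)|`, only trees `H`
contribute to the limit (`tendsto_mean_placements`). The limits of the means are the moments of a
measure by compactness (`exists_measure_of_moments`).

*Upper bound.* A closed walk whose steps form a tree lifts to a closed walk in the universal cover,
and so reduces to the trivial walk when backtracking steps are cancelled. On a rooted tree, the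
function `f = τ ^ depth` satisfies `K f ≤ τ f`: a vertex of degree `d` has at most one neighbour
closer to the root, and `τ⁻¹ + (d - 1) τ = τ (c + d)` because `τ² (1 + c) = 1`. Therefore the walks
that reduce to the trivial walk have total weight at most `n τ ^ k`
(`sum_closedWeight_reduceWalk_le`), the `k`-th moment of the limit is at most `τ ^ k`, and the limit
has no mass beyond `τ`.

*Lower bound.* A positive fraction of the vertices are centers of components that are stars with `m`
leaves. On such a component `K` has the eigenvalues `± l` with `l² = m / ((c + m) (c + 1))`, so that
the `k`-th moment of `1 + x` is at least a constant multiple of `(1 + l) ^ k`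
(`exists_le_mean_trace_one_add_pow`). Hence the limit charges `(x, ∞)` for every `x < l`, and `l`
tends to `τ` as `m` grows.
-/

/-! ### Independent random subsets of a finite set -/

section BernoulliMean

variable {α : Type*}

/-- The expectation of `f t`, where `t` is the random subset of `s` that contains each element of
`s` with probability `p`, independently of the others. -/
noncomputable def bernoulliMean (p : ℝ) (s : Finset α) (f : Finset α → ℝ) : ℝ :=
  ∑ t ∈ s.powerset, p ^ t.card * (1 - p) ^ (s.card - t.card) * f t

variable {p : ℝ} {s : Finset α} {f g : Finset α → ℝ}

@[simp] lemma bernoulliMean_empty : bernoulliMean p ∅ f = f ∅ := by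
  simp [bernoulliMean]

lemma bernoulliMean_congr (h : ∀ t ⊆ s, f t = g t) : bernoulliMean p s f = bernoulliMean p s g :=
  Finset.sum_congr rfl fun t ht => by rw [h t (Finset.mem_powerset.1 ht)]

lemma bernoulliMean_add :
    bernoulliMean p s (fun t => f t + g t) = bernoulliMean p s f + bernoulliMean p s g := by
  simp [bernoulliMean, mul_add, Finset.sum_add_distrib]

lemma bernoulliMean_sub :
    bernoulliMean p s (fun t => f t - g t) = bernoulliMean p s f - bernoulliMean p s g := by
  simp [bernoulliMean, mul_sub, Finset.sum_sub_distrib]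

lemma bernoulliMean_const_mul (c : ℝ) :
    bernoulliMean p s (fun t => c * f t) = c * bernoulliMean p s f := by
  unfold bernoulliMean
  rw [Finset.mul_sum]
  exact Finset.sum_congr rfl fun t _ => by ring

lemma bernoulliMean_sum {β : Type*} (u : Finset β) (F : β → Finset α → ℝ) :
    bernoulliMean p s (fun t => ∑ b ∈ u, F b t) = ∑ b ∈ u, bernoulliMean p s (F b) := by
  unfold bernoulliMean
  rw [Finset.sum_comm]
  exact Finset.sum_congr rfl fun t _ => by rw [Finset.mul_sum]

lemma bernoulliMean_mono (hp0 : 0 ≤ p) (hp1 : p ≤ 1) (h : ∀ t ⊆ s, f t ≤ g t) :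
    bernoulliMean p s f ≤ bernoulliMean p s g :=
  Finset.sum_le_sum fun t ht => mul_le_mul_of_nonneg_left (h t (Finset.mem_powerset.1 ht))
    (mul_nonneg (pow_nonneg hp0 _) (pow_nonneg (sub_nonneg.2 hp1) _))

/-- The expectation of `φ` under the binomial distribution with parameters `N` and `p`. -/
noncomputable def binomialMean (p : ℝ) (N : ℕ) (φ : ℕ → ℝ) : ℝ :=
  ∑ j ∈ Finset.range (N + 1), N.choose j * p ^ j * (1 - p) ^ (N - j) * φ j

/-- The expectation of `φ` under the Poisson distribution with parameter `p`. -/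
noncomputable def poissonMean (p : ℝ) (φ : ℕ → ℝ) : ℝ :=
  ∑' j : ℕ, Real.exp (-p) * p ^ j / j.factorial * φ j

lemma bernoulliMean_card (φ : ℕ → ℝ) :
    bernoulliMean p s (fun t => φ t.card) = binomialMean p s.card φ := by
  unfold bernoulliMean binomialMean
  rw [Finset.sum_powerset_apply_card (fun j => p ^ j * (1 - p) ^ (s.card - j) * φ j)]
  exact Finset.sum_congr rfl fun j _ => by rw [nsmul_eq_mul]; ring

lemma abs_bernoulliMean_le (hp0 : 0 ≤ p) (hp1 : p ≤ 1) (h : ∀ t ⊆ s, |f t| ≤ g t) :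
    |bernoulliMean p s f| ≤ bernoulliMean p s g := by
  rw [abs_le]
  constructor
  · have := bernoulliMean_mono (f := fun t => (-1) * g t) (g := f) (s := s) hp0 hp1
      (fun t ht => by linarith [(abs_le.1 (h t ht)).1])
    rw [bernoulliMean_const_mul] at this
    linarith
  · exact bernoulliMean_mono hp0 hp1 fun t ht => (abs_le.1 (h t ht)).2

variable [DecidableEq α]

/-- Conditioning on whether `a` is chosen. -/
lemma bernoulliMean_insert {a : α} (ha : a ∉ s) :
    bernoulliMean p (insert a s) f =
      (1 - p) * bernoulliMean p s f + p * bernoulliMean p s (fun t => f (insert a t)) := by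
  unfold bernoulliMean
  rw [Finset.sum_powerset_insert ha, Finset.mul_sum, Finset.mul_sum]
  congr 1
  · refine Finset.sum_congr rfl fun t ht => ?_
    have hts := Finset.card_le_card (Finset.mem_powerset.1 ht)
    rw [Finset.card_insert_of_notMem ha, Nat.sub_add_comm hts, pow_succ]
    ring
  · refine Finset.sum_congr rfl fun t ht => ?_
    have hat : a ∉ t := fun h => ha (Finset.mem_powerset.1 ht h)
    rw [Finset.card_insert_of_notMem ha, Finset.card_insert_of_notMem hat, Nat.add_sub_add_right,
      pow_succ]
    ring

lemma bernoulliMean_const (c : ℝ) : bernoulliMean p s (fun _ => c) = c := by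
  induction s using Finset.induction_on with
  | empty => simp
  | insert a s ha ih => rw [bernoulliMean_insert ha, ih]; ring

lemma bernoulliMean_nonneg (hp0 : 0 ≤ p) (hp1 : p ≤ 1) (h : ∀ t ⊆ s, 0 ≤ f t) :
    0 ≤ bernoulliMean p s f := by
  simpa [bernoulliMean_const] using bernoulliMean_mono (g := f) (f := fun _ => 0) hp0 hp1 h

lemma sq_bernoulliMean_le (hp0 : 0 ≤ p) (hp1 : p ≤ 1) {C : ℝ} (h : ∀ t ⊆ s, |f t| ≤ C) :
    bernoulliMean p s f ^ 2 ≤ C ^ 2 := by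
  have := abs_bernoulliMean_le (g := fun _ => C) hp0 hp1 h
  rw [bernoulliMean_const] at this
  exact sq_le_sq.2 (this.trans (le_abs_self C))

/-- The Efron–Stein inequality: if adding one element changes `f` by at most `C`, then the variance
of `f` is at most `|s| p (1 - p) C²`. -/
lemma bernoulliMean_variance_le (hp0 : 0 ≤ p) (hp1 : p ≤ 1) {C : ℝ}
    (h : ∀ a ∈ s, ∀ t ⊆ s, a ∉ t → |f (insert a t) - f t| ≤ C) :
    bernoulliMean p s (fun t => f t ^ 2) - bernoulliMean p s f ^ 2
      ≤ s.card * (p * (1 - p)) * C ^ 2 := by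
  induction s using Finset.induction_on generalizing f with
  | empty => simp
  | insert a s ha ih =>
    rw [bernoulliMean_insert ha, bernoulliMean_insert ha, Finset.card_insert_of_notMem ha]
    have h0 := ih (f := f) fun b hb t ht hbt =>
      h b (Finset.mem_insert_of_mem hb) t (ht.trans (Finset.subset_insert _ _)) hbt
    have h1 := ih (f := fun t => f (insert a t)) fun b hb t ht hbt => by
      have hba : b ≠ a := fun hba => ha (hba ▸ hb)
      have := h b (Finset.mem_insert_of_mem hb) (insert a t) (Finset.insert_subset_insert _ ht)
        (by simp [hba, hbt])
      rwa [Finset.insert_comm] at this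
    have h2 := sq_bernoulliMean_le (f := fun t => f (insert a t) - f t) (s := s) hp0 hp1
      (C := C) fun t ht => h a (Finset.mem_insert_self _ _) t
        (ht.trans (Finset.subset_insert _ _)) fun hat => ha (ht hat)
    rw [bernoulliMean_sub] at h2
    push_cast
    -- the variance splits into the mean conditional variance and the variance of the
    -- conditional mean, and the latter is `p (1 - p)` times the square of a difference of means
    have h3 := mul_le_mul_of_nonneg_left h0 (sub_nonneg.2 hp1)
    have h4 := mul_le_mul_of_nonneg_left h1 hp0
    have h5 := mul_le_mul_of_nonneg_left h2 (mul_nonneg hp0 (sub_nonneg.2 hp1))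
    nlinarith [h3, h4, h5]

/-- Conditioning on a single element being chosen. -/
lemma bernoulliMean_ite_mem {a : α} (ha : a ∈ s) :
    bernoulliMean p s (fun t => if a ∈ t then f t else 0) =
      p * bernoulliMean p s (fun t => f (insert a t)) := by
  obtain ⟨u, hu, rfl⟩ : ∃ u, a ∉ u ∧ insert a u = s :=
    ⟨s.erase a, Finset.notMem_erase a s, Finset.insert_erase ha⟩
  rw [bernoulliMean_insert hu, bernoulliMean_insert hu]
  have : bernoulliMean p u (fun t => if a ∈ t then f t else 0) = 0 := by
    rw [bernoulliMean_congr (g := fun _ => 0) fun t ht => if_neg fun h => hu (ht h),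
      bernoulliMean_const]
  rw [this]
  simp only [Finset.mem_insert_self, if_true, Finset.insert_idem]
  ring

/-- Conditioning on all elements of `h` being chosen. -/
lemma bernoulliMean_ite_subset {h : Finset α} (hs : h ⊆ s) :
    bernoulliMean p s (fun t => if h ⊆ t then f t else 0) =
      p ^ h.card * bernoulliMean p s (fun t => f (t ∪ h)) := by
  induction h using Finset.induction_on generalizing f with
  | empty => simp
  | insert a h ha ih =>
    have hah := Finset.insert_subset_iff.1 hs
    have : (fun t => if insert a h ⊆ t then f t else 0) =
        fun t => if h ⊆ t then (if a ∈ t then f t else 0) else 0 := by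
      funext t
      simp only [Finset.insert_subset_iff]
      split_ifs <;> tauto
    rw [this, ih hah.2]
    have : (fun t => if a ∈ t ∪ h then f (t ∪ h) else 0) =
        fun t => if a ∈ t then f (t ∪ h) else 0 := by
      funext t
      simp [ha]
    rw [this, bernoulliMean_ite_mem hah.1, Finset.card_insert_of_notMem ha, pow_succ, mul_assoc]
    congr 3
    funext t
    rw [Finset.insert_union, Finset.union_insert]

/-- The numbers of chosen elements in disjoint sets are independent. -/
lemma bernoulliMean_prod_inter {Q : Type*} [Fintype Q] [DecidableEq Q] (A : Q → Finset α)
    (hA : Pairwise fun q r => Disjoint (A q) (A r)) (φ : Q → ℕ → ℝ) :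
    bernoulliMean p s (fun t => ∏ q, φ q (t ∩ A q).card) =
      ∏ q, bernoulliMean p (s ∩ A q) (fun t => φ q t.card) := by
  induction s using Finset.induction_on generalizing φ with
  | empty => simp
  | insert a s ha ih =>
    rw [bernoulliMean_insert ha, ih]
    by_cases hq : ∃ q, a ∈ A q
    · obtain ⟨q, hq⟩ := hq
      have hne : ∀ r, r ≠ q → a ∉ A r := fun r hr har =>
        Finset.disjoint_left.1 (hA hr) har hq
      have h1 : bernoulliMean p s (fun t => ∏ r, φ r (insert a t ∩ A r).card) =
          bernoulliMean p s (fun t => ∏ r,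
            Function.update φ q (fun d => φ q (d + 1)) r (t ∩ A r).card) := by
        refine bernoulliMean_congr fun t ht => Finset.prod_congr rfl fun r _ => ?_
        by_cases hr : r = q
        · subst hr
          rw [Function.update_self, Finset.insert_inter_of_mem hq, Finset.card_insert_of_notMem]
          exact fun h => ha (ht (Finset.mem_inter.1 h).1)
        · rw [Function.update_of_ne hr, Finset.insert_inter_of_notMem (hne r hr)]
      rw [h1, ih, Fintype.prod_eq_mul_prod_compl q, Fintype.prod_eq_mul_prod_compl q,
        Fintype.prod_eq_mul_prod_compl q]
      have h2 : ∏ r ∈ {q}ᶜ, bernoulliMean p (s ∩ A r)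
            (fun t => Function.update φ q (fun d => φ q (d + 1)) r t.card) =
          ∏ r ∈ {q}ᶜ, bernoulliMean p (s ∩ A r) (fun t => φ r t.card) := by
        refine Finset.prod_congr rfl fun r hr => ?_
        rw [Function.update_of_ne (by simpa using hr)]
      have h3 : ∏ r ∈ {q}ᶜ, bernoulliMean p (insert a s ∩ A r) (fun t => φ r t.card) =
          ∏ r ∈ {q}ᶜ, bernoulliMean p (s ∩ A r) (fun t => φ r t.card) := by
        refine Finset.prod_congr rfl fun r hr => ?_
        rw [Finset.insert_inter_of_notMem (hne r (by simpa using hr))]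
      have ha' : a ∉ s ∩ A q := fun h => ha (Finset.mem_inter.1 h).1
      have h4 : bernoulliMean p (s ∩ A q) (fun t => φ q (insert a t).card) =
          bernoulliMean p (s ∩ A q) (fun t => φ q (t.card + 1)) :=
        bernoulliMean_congr fun t ht => by
          rw [Finset.card_insert_of_notMem fun h => ha' (ht h)]
      rw [h2, h3, Finset.insert_inter_of_mem hq, bernoulliMean_insert ha', h4, Function.update_self]
      ring
    · push Not at hq
      simp only [Finset.insert_inter_of_notMem (hq _)]
      rw [ih]
      ring

end BernoulliMean

/-- The law of rare events, for bounded test functions. -/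
lemma tendsto_binomialMean {p : ℝ} (hp : 0 < p) (r : ℕ) {φ : ℕ → ℝ} (hφ : ∀ j, |φ j| ≤ 1) :
    Tendsto (fun n : ℕ => binomialMean (p / n) (n - r) φ) atTop (𝓝 (poissonMean p φ)) := by
  rw [← tendsto_add_atTop_iff_nat r]
  simp only [Nat.add_sub_cancel]
  have hsum : ∀ n : ℕ, binomialMean (p / (n + r : ℕ)) n φ =
      ∑' j : ℕ, n.choose j * (p / (n + r : ℕ)) ^ j * (1 - p / (n + r : ℕ)) ^ (n - j) * φ j := by
    intro n
    rw [binomialMean, tsum_eq_sum]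
    intro j hj
    rw [Nat.choose_eq_zero_of_lt (by simpa using hj)]
    simp
  simp only [hsum]
  -- the binomial weights of mean at most `p` are dominated by the terms of the series of `exp p`
  refine tendsto_tsum_of_dominated_convergence (bound := fun j => p ^ j / j.factorial)
    (Real.summable_pow_div_factorial p) (fun j => ?_) ?_
  · refine Tendsto.mul_const _ ?_
    refine tendsto_choose_mul_pow_of_tendsto_mul_atTop j ?_
    have h1 : Tendsto (fun n : ℕ => p - p * r / ((n : ℝ) + r)) atTop (𝓝 (p - 0)) := by
      refine tendsto_const_nhds.sub (Tendsto.div_atTop tendsto_const_nhds ?_)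
      exact tendsto_atTop_add_const_right _ _ tendsto_natCast_atTop_atTop
    rw [sub_zero] at h1
    refine h1.congr' ?_
    filter_upwards [eventually_gt_atTop 0] with n hn
    have : (0 : ℝ) < n := by exact_mod_cast hn
    push_cast
    field_simp
    ring
  · filter_upwards [eventually_ge_atTop (⌈p⌉₊ + 1)] with n hn j
    have hpn : p ≤ (n + r : ℕ) := by
      have h1 := Nat.le_ceil p
      have h2 : ((⌈p⌉₊ + 1 : ℕ) : ℝ) ≤ n := by exact_mod_cast hn
      push_cast at h2 ⊢
      have : (0 : ℝ) ≤ r := Nat.cast_nonneg r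
      linarith
    have hpos : (0 : ℝ) < (n + r : ℕ) := hp.trans_le hpn
    have hx0 : 0 ≤ p / (n + r : ℕ) := by positivity
    have hx1 : p / (n + r : ℕ) ≤ 1 := (div_le_one hpos).2 hpn
    have hy0 : 0 ≤ 1 - p / (n + r : ℕ) := sub_nonneg.2 hx1
    rw [Real.norm_eq_abs, abs_mul, abs_of_nonneg (by positivity)]
    calc _ ≤ ((n : ℝ) ^ j / j.factorial * (p / (n + r : ℕ)) ^ j * 1) * 1 := by
          gcongr
          · exact Nat.choose_le_pow_div j n
          · exact pow_le_one₀ hy0 (by linarith)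
          · exact hφ j
      _ = (n * (p / (n + r : ℕ))) ^ j / j.factorial := by rw [mul_pow]; ring
      _ ≤ p ^ j / j.factorial := by
          gcongr
          rw [mul_div_assoc', div_le_iff₀ hpos, mul_comm]
          gcongr
          simp

/-! ### Placements of a fixed graph in the binomial random graph -/

section RandomGraph

variable {V : Type*} [Fintype V] [DecidableEq V]

/-- The expectation of `F G`, where `G` is the binomial random graph on `V` with edge
probability `p`. -/
noncomputable def graphMean (p : ℝ) (F : SimpleGraph V → ℝ) : ℝ :=
  bernoulliMean p (⊤ : SimpleGraph V).edgeFinset (fun t => F (SimpleGraph.fromEdgeSet t))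

instance : MeasurableSingletonClass (SimpleGraph V) where
  measurableSet_singleton G := by
    have : ({G} : Set (SimpleGraph V)) = SimpleGraph.edgeSet ⁻¹' {G.edgeSet} := by
      ext; simp
    rw [this]
    exact SimpleGraph.measurable_edgeSet (measurableSet_singleton _)

open scoped Classical in
lemma binomialRandom_real_setOf (q : unitInterval) (P : SimpleGraph V → Prop) :
    (SimpleGraph.binomialRandom V q).real {G | P G} =
      graphMean q fun G => if P G then 1 else 0 := by
  have h1 : (SimpleGraph.binomialRandom V q).real {G | P G} =
      ∑ G : SimpleGraph V, (SimpleGraph.binomialRandom V q).real {G} * (if P G then 1 else 0) := by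
    have : {G | P G} = ((Finset.univ.filter P : Finset (SimpleGraph V)) : Set (SimpleGraph V)) := by
      ext; simp
    rw [this, ← sum_measureReal_singleton, Finset.sum_filter]
    simp
  rw [h1]
  unfold graphMean bernoulliMean
  -- graphs correspond to sets of edges
  refine Finset.sum_bij' (fun G _ => G.edgeFinset) (fun t _ => SimpleGraph.fromEdgeSet (t : Set _))
    ?_ ?_ ?_ ?_ ?_
  · intro G _
    rw [Finset.mem_powerset]
    exact SimpleGraph.edgeFinset_mono le_top
  · simp
  · intro G _
    simp
  · intro t ht
    rw [Finset.mem_powerset] at ht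
    ext e
    have : e ∈ t → ¬ e.IsDiag := fun he => by simpa using ht he
    simpa using this
  · intro G _
    have h2 : G.edgeSet.ncard = G.edgeFinset.card := by
      rw [← SimpleGraph.coe_edgeFinset, Set.ncard_coe_finset]
    have h3 : (Nat.card V).choose 2 = (⊤ : SimpleGraph V).edgeFinset.card := by
      rw [SimpleGraph.card_edgeFinset_top_eq_card_choose_two, Nat.card_eq_fintype_card]
    rw [measureReal_def, SimpleGraph.binomialRandom_singleton, h2, h3]
    simp

/-- The degree of a vertex, free of decidability data. -/
noncomputable def SimpleGraph.ndeg {W : Type*} (G : SimpleGraph W) (v : W) : ℕ :=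
  (G.neighborSet v).ncard

lemma abs_prod_sub_prod_le_one {Q : Type*} [Fintype Q] {f g : Q → ℝ} (hf0 : ∀ q, 0 ≤ f q)
    (hf1 : ∀ q, f q ≤ 1) (hg0 : ∀ q, 0 ≤ g q) (hg1 : ∀ q, g q ≤ 1) :
    |∏ q, f q - ∏ q, g q| ≤ 1 := by
  have h1 := Finset.prod_nonneg fun q (_ : q ∈ Finset.univ) => hf0 q
  have h2 := Finset.prod_nonneg fun q (_ : q ∈ Finset.univ) => hg0 q
  have h3 := Finset.prod_le_one (fun q (_ : q ∈ Finset.univ) => hf0 q) fun q _ => hf1 q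
  have h4 := Finset.prod_le_one (fun q (_ : q ∈ Finset.univ) => hg0 q) fun q _ => hg1 q
  rw [abs_le]
  constructor <;> linarith

/-- If no edge of `t` joins two vertices in the image of `ι`, then planting a copy of `H` on this
image adds its degrees to the numbers of edges of `t` that lead out of the image. -/
lemma ndeg_fromEdgeSet_union {Q : Type*} [Fintype Q] (H : SimpleGraph Q) (ι : Q ↪ V)
    (t : Finset (Sym2 V)) (ht : ∀ a b, s(ι a, ι b) ∉ t) (q : Q) :
    (SimpleGraph.fromEdgeSet ((t : Set (Sym2 V)) ∪ (H.map ι).edgeSet)).ndeg (ι q) =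
      H.ndeg q + (t ∩ (Finset.univ \ Finset.univ.map ι).image (fun w => s(ι q, w))).card := by
  classical
  have h1 : (SimpleGraph.fromEdgeSet ((t : Set (Sym2 V)) ∪ (H.map ι).edgeSet)).neighborSet (ι q) =
      ι '' (H.neighborSet q) ∪
        ((Finset.univ \ Finset.univ.map ι).filter fun w => s(ι q, w) ∈ t : Finset V) := by
    ext w
    simp only [SimpleGraph.mem_neighborSet, SimpleGraph.fromEdgeSet_adj, Set.mem_union,
      Finset.mem_coe, SimpleGraph.mem_edgeSet, SimpleGraph.map_adj, Set.mem_image,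
      Finset.mem_filter, Finset.mem_sdiff, Finset.mem_univ, true_and, Finset.mem_map]
    constructor
    · rintro ⟨h | ⟨a, b, hab, ha, rfl⟩, hne⟩
      · refine Or.inr ⟨?_, h⟩
        rintro ⟨b, rfl⟩
        exact ht _ _ h
      · obtain rfl := ι.injective ha
        exact Or.inl ⟨b, hab, rfl⟩
    · rintro (⟨b, hb, rfl⟩ | ⟨h1, h2⟩)
      · exact ⟨Or.inr ⟨q, b, hb, rfl, rfl⟩, fun h => hb.ne (ι.injective h)⟩
      · exact ⟨Or.inl h2, fun h => h1 ⟨q, h⟩⟩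
  rw [SimpleGraph.ndeg, h1, Set.ncard_union_eq _ (Set.toFinite _) (Set.toFinite _),
    Set.ncard_image_of_injective _ ι.injective, Set.ncard_coe_finset, SimpleGraph.ndeg]
  · congr 1
    have hinj : Function.Injective fun w => s(ι q, w) := fun a b hab => Sym2.congr_right.1 hab
    rw [← Finset.card_image_of_injective _ hinj]
    congr 1
    ext e
    simp only [Finset.mem_image, Finset.mem_filter, Finset.mem_inter]
    constructor
    · rintro ⟨w, ⟨h1, h2⟩, rfl⟩
      exact ⟨h2, w, h1, rfl⟩
    · rintro ⟨h2, w, h1, rfl⟩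
      exact ⟨w, ⟨h1, h2⟩, rfl⟩
  · rw [Set.disjoint_left]
    rintro _ ⟨b, _, rfl⟩ h
    simp at h

open scoped Classical in
/-- The probability that a fixed placement `ι` of the graph `H` is present, weighted by functions
of the degrees: given its presence, the degrees are up to an error of order `p` those in `H`, plus
independent binomial numbers of edges leading out of the placement. -/
lemma abs_graphMean_placement_sub_le {Q : Type*} [Fintype Q] (H : SimpleGraph Q) (ι : Q ↪ V)
    {φ : Q → ℕ → ℝ} (h0 : ∀ q d, 0 ≤ φ q d) (h1 : ∀ q d, φ q d ≤ 1) {p : ℝ} (hp0 : 0 ≤ p)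
    (hp1 : p ≤ 1) :
    |graphMean p (fun G => if H.map ι ≤ G then ∏ q, φ q (G.ndeg (ι q)) else 0) -
      p ^ H.edgeSet.ncard *
        ∏ q, binomialMean p (Fintype.card V - Fintype.card Q) (fun d => φ q (H.ndeg q + d))| ≤
      p ^ H.edgeSet.ncard * ((Fintype.card Q : ℝ) ^ 2 * p) := by
  set s := (⊤ : SimpleGraph V).edgeFinset with hs
  set h := (H.map ι).edgeFinset with hh
  have hhs : h ⊆ s := SimpleGraph.edgeFinset_mono le_top
  have hcard : h.card = H.edgeSet.ncard := by
    rw [← Set.ncard_coe_finset, hh, SimpleGraph.coe_edgeFinset, SimpleGraph.edgeSet_map]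
    exact Set.ncard_image_of_injective _ (Function.Embedding.sym2Map ι).injective
  have e1 : graphMean p (fun G => if H.map ι ≤ G then ∏ q, φ q (G.ndeg (ι q)) else 0) =
      p ^ H.edgeSet.ncard * bernoulliMean p s fun t =>
        ∏ q, φ q ((SimpleGraph.fromEdgeSet ((t : Set (Sym2 V)) ∪ (H.map ι).edgeSet)).ndeg (ι q)) := by
    rw [← hcard, graphMean, ← hs]
    have := bernoulliMean_ite_subset (p := p) (s := s) (h := h)
      (f := fun t => ∏ q, φ q ((SimpleGraph.fromEdgeSet (t : Set (Sym2 V))).ndeg (ι q))) hhs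
    simp only [Finset.coe_union, hh, SimpleGraph.coe_edgeFinset] at this
    rw [hh, ← this]
    refine bernoulliMean_congr fun t ht => ?_
    have : H.map ι ≤ SimpleGraph.fromEdgeSet (t : Set (Sym2 V)) ↔ (H.map ι).edgeFinset ⊆ t := by
      rw [← SimpleGraph.edgeSet_subset_edgeSet, SimpleGraph.edgeSet_fromEdgeSet,
        ← SimpleGraph.coe_edgeFinset]
      constructor
      · intro h' e he
        exact (h' he).1
      · intro h' e he
        refine ⟨h' he, ?_⟩
        simpa [hs] using ht (h' he)
    simp only [this]
  set A : Q → Finset (Sym2 V) :=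
    fun q => (Finset.univ \ Finset.univ.map ι).image (fun w => s(ι q, w)) with hA
  have hAs : ∀ q, A q ⊆ s := by
    intro q e he
    simp only [hA, Finset.mem_image, Finset.mem_sdiff, Finset.mem_univ, true_and,
      Finset.mem_map, not_exists] at he
    obtain ⟨w, hw, rfl⟩ := he
    simpa [hs] using hw q
  have hAcard : ∀ q, (A q).card = Fintype.card V - Fintype.card Q := by
    intro q
    have hinj : Function.Injective fun w => s(ι q, w) := fun a b hab => Sym2.congr_right.1 hab
    rw [hA, Finset.card_image_of_injective _ hinj, Finset.card_sdiff_of_subset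
      (Finset.subset_univ _), Finset.card_map, Finset.card_univ, Finset.card_univ]
  have hAdisj : Pairwise fun q r => Disjoint (A q) (A r) := by
    intro q r hqr
    rw [Finset.disjoint_left]
    intro e he he'
    simp only [hA, Finset.mem_image, Finset.mem_sdiff, Finset.mem_univ, true_and,
      Finset.mem_map, not_exists] at he he'
    obtain ⟨w, hw, rfl⟩ := he
    obtain ⟨w', hw', h'⟩ := he'
    rw [Sym2.eq_iff] at h'
    rcases h' with ⟨h', -⟩ | ⟨h', -⟩
    · exact hqr (ι.injective h').symm
    · exact hw r h'
  have e2 : ∏ q, binomialMean p (Fintype.card V - Fintype.card Q) (fun d => φ q (H.ndeg q + d)) =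
      bernoulliMean p s fun t => ∏ q, φ q (H.ndeg q + (t ∩ A q).card) := by
    rw [bernoulliMean_prod_inter A hAdisj fun q d => φ q (H.ndeg q + d)]
    refine Finset.prod_congr rfl fun q _ => ?_
    rw [bernoulliMean_card (fun d => φ q (H.ndeg q + d)), Finset.inter_eq_right.2 (hAs q),
      hAcard]
  rw [e1, e2, ← mul_sub, abs_mul, abs_of_nonneg (pow_nonneg hp0 _), ← bernoulliMean_sub]
  refine mul_le_mul_of_nonneg_left ?_ (pow_nonneg hp0 _)
  set I : Finset (Sym2 V) := (Finset.univ : Finset (Q × Q)).image fun x => s(ι x.1, ι x.2) with hI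
  have hIcard : (I.card : ℝ) ≤ (Fintype.card Q : ℝ) ^ 2 := by
    have : I.card ≤ Fintype.card Q ^ 2 := by
      refine Finset.card_image_le.trans ?_
      rw [Finset.card_univ, Fintype.card_prod, sq]
    exact_mod_cast this
  -- the two products agree unless some edge of `t` joins two vertices of the placement
  calc _ ≤ bernoulliMean p s fun t => ∑ e ∈ I, if e ∈ t then (1 : ℝ) else 0 := by
        refine abs_bernoulliMean_le hp0 hp1 fun t ht => ?_
        by_cases hI' : ∃ a b, s(ι a, ι b) ∈ t
        · obtain ⟨a, b, hab⟩ := hI'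
          refine (abs_prod_sub_prod_le_one (fun q => h0 _ _) (fun q => h1 _ _)
            (fun q => h0 _ _) (fun q => h1 _ _)).trans ?_
          have : s(ι a, ι b) ∈ I := Finset.mem_image.2 ⟨(a, b), Finset.mem_univ _, rfl⟩
          refine le_trans ?_ (Finset.single_le_sum (fun e _ => ?_) this)
          · rw [if_pos hab]
          · split_ifs <;> norm_num
        · push Not at hI'
          simp only [ndeg_fromEdgeSet_union H ι t hI', sub_self, abs_zero, hA]
          exact Finset.sum_nonneg fun e _ => by split_ifs <;> norm_num
    _ = ∑ e ∈ I, bernoulliMean p s fun t => if e ∈ t then (1 : ℝ) else 0 :=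
        bernoulliMean_sum _ _
    _ ≤ ∑ e ∈ I, p := by
        refine Finset.sum_le_sum fun e _ => ?_
        by_cases he : e ∈ s
        · rw [bernoulliMean_ite_mem (f := fun _ => 1) he, bernoulliMean_const, mul_one]
        · rw [bernoulliMean_congr (g := fun _ => 0) fun t ht => if_neg fun h' => he (ht h'),
            bernoulliMean_const]
          exact hp0
    _ ≤ _ := by
        rw [Finset.sum_const, nsmul_eq_mul]
        exact mul_le_mul_of_nonneg_right hIcard hp0

end RandomGraph

/-- The limit of `n⁻¹ · n (n - 1) ⋯ (n - r + 1) · (p / n) ^ e` when `e + 1 ≥ r`. -/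
lemma tendsto_descFactorial_mul_pow {p : ℝ} {r e : ℕ} (h : r ≤ e + 1) :
    Tendsto (fun n : ℕ => (n : ℝ)⁻¹ * (n.descFactorial r * (p / n) ^ e)) atTop
      (𝓝 (if r = e + 1 then p ^ e else 0)) := by
  have hfac : ∀ i : ℕ, Tendsto (fun n : ℕ => ((n - i : ℕ) : ℝ) / n) atTop (𝓝 1) := by
    intro i
    have h1 : Tendsto (fun n : ℕ => (1 : ℝ) - i / n) atTop (𝓝 (1 - 0)) :=
      tendsto_const_nhds.sub (tendsto_const_div_atTop_nhds_zero_nat _)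
    rw [sub_zero] at h1
    refine h1.congr' ?_
    filter_upwards [eventually_ge_atTop (i + 1)] with n hn
    have : (0 : ℝ) < n := by exact_mod_cast (by omega : 0 < n)
    rw [Nat.cast_sub (by omega)]
    field_simp
  have hdesc : Tendsto (fun n : ℕ => (n.descFactorial r : ℝ) / n ^ r) atTop (𝓝 1) := by
    have : Tendsto (fun n : ℕ => ∏ i ∈ Finset.range r, ((n - i : ℕ) : ℝ) / n) atTop
        (𝓝 (∏ i ∈ Finset.range r, 1)) := tendsto_finsetProd _ fun i _ => hfac i
    simp only [Finset.prod_const_one, Finset.prod_div_distrib, Finset.prod_const,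
      Finset.card_range] at this
    simpa only [Nat.descFactorial_eq_prod_range, Nat.cast_prod] using this
  obtain ⟨k, hk⟩ := Nat.exists_eq_add_of_le h
  have hpow : Tendsto (fun n : ℕ => p ^ e * ((n : ℝ)⁻¹) ^ k) atTop
      (𝓝 (if r = e + 1 then p ^ e else 0)) := by
    split_ifs with hr
    · obtain rfl : k = 0 := by omega
      simp
    · have : k ≠ 0 := by omega
      have h2 := (tendsto_inv_atTop_nhds_zero_nat (𝕜 := ℝ)).pow k
      rw [zero_pow this] at h2
      simpa using h2.const_mul (p ^ e)
  have := hdesc.mul hpow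
  rw [one_mul] at this
  refine this.congr' ?_
  filter_upwards [eventually_gt_atTop 0] with n hn
  have : (n : ℝ) ≠ 0 := by exact_mod_cast hn.ne'
  have hne : (n : ℝ) * n ^ e = n ^ r * n ^ k := by rw [← pow_succ', hk, pow_add]
  rw [div_pow, inv_pow]
  field_simp
  linear_combination (n.descFactorial r : ℝ) * p ^ e * hne

open scoped Classical in
/-- The mean number of placements of a graph `H` with at most one vertex more than it has edges,
weighted by functions of the degrees. In the limit, the degrees of the vertices exceed those in `H`
by independent Poisson numbers, and only those `H` with exactly one vertex more than edges count. -/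
lemma tendsto_mean_placements {Q : Type} [Fintype Q] (H : SimpleGraph Q)
    (hH : Fintype.card Q ≤ H.edgeSet.ncard + 1) {φ : Q → ℕ → ℝ} (h0 : ∀ q d, 0 ≤ φ q d)
    (h1 : ∀ q d, φ q d ≤ 1) {p : ℝ} (hp : 0 < p) :
    Tendsto (fun n : ℕ => (n : ℝ)⁻¹ * ∑ ι : Q ↪ Fin n, graphMean (p / n)
        (fun G => if H.map ι ≤ G then ∏ q, φ q (G.ndeg (ι q)) else 0)) atTop
      (𝓝 ((if Fintype.card Q = H.edgeSet.ncard + 1 then p ^ H.edgeSet.ncard else 0) *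
        ∏ q, poissonMean p (fun d => φ q (H.ndeg q + d)))) := by
  have hT := tendsto_descFactorial_mul_pow (p := p) hH
  set r := Fintype.card Q
  set e := H.edgeSet.ncard
  have hmain : Tendsto (fun n : ℕ => (n : ℝ)⁻¹ * (n.descFactorial r * (p / n) ^ e) *
      ∏ q, binomialMean (p / n) (n - r) (fun d => φ q (H.ndeg q + d))) atTop
      (𝓝 ((if r = e + 1 then p ^ e else 0) *
        ∏ q, poissonMean p (fun d => φ q (H.ndeg q + d)))) := by
    refine hT.mul (tendsto_finsetProd _ fun q _ => tendsto_binomialMean hp r fun j => ?_)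
    rw [abs_of_nonneg (h0 _ _)]
    exact h1 _ _
  have herr : Tendsto (fun n : ℕ => (n : ℝ)⁻¹ * (n.descFactorial r * (p / n) ^ e) *
      ((r : ℝ) ^ 2 * (p / n))) atTop (𝓝 0) := by
    have h2 : Tendsto (fun n : ℕ => (r : ℝ) ^ 2 * (p / n)) atTop (𝓝 ((r : ℝ) ^ 2 * 0)) :=
      (tendsto_const_div_atTop_nhds_zero_nat p).const_mul _
    simpa using hT.mul h2
  refine (tendsto_iff_of_dist ?_).2 hmain
  refine squeeze_zero' (Eventually.of_forall fun n => dist_nonneg) ?_ herr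
  filter_upwards [eventually_ge_atTop (⌈p⌉₊ + 1)] with n hn
  have hpn : p ≤ n := (Nat.le_ceil p).trans (by exact_mod_cast (Nat.le_succ _).trans hn)
  have hpos : (0 : ℝ) < n := hp.trans_le hpn
  have hq0 : 0 ≤ p / n := by positivity
  have hq1 : p / n ≤ 1 := (div_le_one hpos).2 hpn
  have hconst : (n : ℝ)⁻¹ * (n.descFactorial r * (p / n) ^ e) *
      ∏ q, binomialMean (p / n) (n - r) (fun d => φ q (H.ndeg q + d)) =
      (n : ℝ)⁻¹ * ∑ _ι : Q ↪ Fin n, (p / n) ^ e *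
        ∏ q, binomialMean (p / n) (n - r) (fun d => φ q (H.ndeg q + d)) := by
    rw [Finset.sum_const, Finset.card_univ, Fintype.card_embedding_eq, Fintype.card_fin,
      nsmul_eq_mul]
    ring
  rw [Real.dist_eq, hconst, ← mul_sub, ← Finset.sum_sub_distrib, abs_mul,
    abs_of_nonneg (inv_nonneg.2 hpos.le), mul_assoc, mul_assoc]
  refine mul_le_mul_of_nonneg_left ?_ (inv_nonneg.2 hpos.le)
  refine (Finset.abs_sum_le_sum_abs _ _).trans ?_
  refine (Finset.sum_le_sum fun ι _ => ?_).trans_eq (b := ∑ _ι : Q ↪ Fin n,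
    (p / n) ^ e * ((r : ℝ) ^ 2 * (p / n))) ?_
  · have := abs_graphMean_placement_sub_le H ι h0 h1 hq0 hq1
    rwa [Fintype.card_fin] at this
  · rw [Finset.sum_const, Finset.card_univ, Fintype.card_embedding_eq, Fintype.card_fin,
      nsmul_eq_mul]

/-! ### The matrix `K`: substochasticity, eigenvalues, and the effect of an edge -/

section Substochastic

variable {V : Type*} [Fintype V]

/-- A matrix is substochastic if its entries are nonnegative and its row sums are at most `1`. -/
def IsSubstochastic (M : Matrix V V ℝ) : Prop :=
  (∀ i j, 0 ≤ M i j) ∧ ∀ i, ∑ j, M i j ≤ 1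

lemma IsSubstochastic.one [DecidableEq V] : IsSubstochastic (1 : Matrix V V ℝ) := by
  refine ⟨fun i j => ?_, fun i => ?_⟩
  · rw [Matrix.one_apply]
    split_ifs <;> norm_num
  · simp [Matrix.one_apply]

lemma IsSubstochastic.mul {M N : Matrix V V ℝ} (hM : IsSubstochastic M) (hN : IsSubstochastic N) :
    IsSubstochastic (M * N) := by
  refine ⟨fun i j => ?_, fun i => ?_⟩
  · rw [Matrix.mul_apply]
    exact Finset.sum_nonneg fun k _ => mul_nonneg (hM.1 _ _) (hN.1 _ _)
  · simp only [Matrix.mul_apply]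
    rw [Finset.sum_comm]
    calc ∑ k, ∑ j, M i k * N k j = ∑ k, M i k * ∑ j, N k j := by simp only [Finset.mul_sum]
      _ ≤ ∑ k, M i k * 1 :=
          Finset.sum_le_sum fun k _ => mul_le_mul_of_nonneg_left (hN.2 k) (hM.1 _ _)
      _ ≤ 1 := by simpa using hM.2 i

lemma IsSubstochastic.pow [DecidableEq V] {M : Matrix V V ℝ} (hM : IsSubstochastic M) (k : ℕ) :
    IsSubstochastic (M ^ k) := by
  induction k with
  | zero => simpa using IsSubstochastic.one
  | succ k ih => rw [pow_succ]; exact ih.mul hM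

lemma IsSubstochastic.apply_le_one {M : Matrix V V ℝ} (hM : IsSubstochastic M) (i j : V) :
    M i j ≤ 1 :=
  (Finset.single_le_sum (fun k _ => hM.1 i k) (Finset.mem_univ j)).trans (hM.2 i)

lemma IsSubstochastic.trace_le {M : Matrix V V ℝ} (hM : IsSubstochastic M) :
    M.trace ≤ Fintype.card V := by
  calc M.trace ≤ ∑ _i : V, (1 : ℝ) := Finset.sum_le_sum fun i _ => hM.apply_le_one i i
    _ = _ := by simp

/-- Replacing two rows of a substochastic matrix changes the trace of its product with another one
by at most `4`, as each row has `ℓ¹` norm at most `1`. -/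
lemma abs_trace_mul_sub_le [DecidableEq V] {M N C : Matrix V V ℝ} (hM : IsSubstochastic M) (hN : IsSubstochastic N)
    (hC : IsSubstochastic C) {u v : V} (h : ∀ i, i ≠ u → i ≠ v → ∀ j, M i j = N i j) :
    |(C * (M - N)).trace| ≤ 4 := by
  have hrow : ∀ i, |∑ j, (M i j - N i j) * C j i| ≤ 2 := by
    intro i
    calc |∑ j, (M i j - N i j) * C j i| ≤ ∑ j, |(M i j - N i j) * C j i| :=
          Finset.abs_sum_le_sum_abs _ _
      _ ≤ ∑ j, (M i j + N i j) := by
          refine Finset.sum_le_sum fun j _ => ?_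
          have h1 := hM.1 i j
          have h2 := hN.1 i j
          rw [abs_mul, abs_of_nonneg (hC.1 j i)]
          calc |M i j - N i j| * C j i ≤ |M i j - N i j| * 1 :=
                mul_le_mul_of_nonneg_left (hC.apply_le_one j i) (abs_nonneg _)
            _ ≤ M i j + N i j := by
                rw [mul_one, abs_le]
                constructor <;> linarith
      _ ≤ 2 := by
          rw [Finset.sum_add_distrib]
          linarith [hM.2 i, hN.2 i]
  have hzero : ∀ i ∉ ({u, v} : Finset V), |∑ j, (M i j - N i j) * C j i| = 0 := by
    intro i hi
    simp only [Finset.mem_insert, Finset.mem_singleton, not_or] at hi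
    simp [h i hi.1 hi.2]
  rw [Matrix.trace_mul_comm]
  calc |((M - N) * C).trace| = |∑ i, ∑ j, (M i j - N i j) * C j i| := by
        simp [Matrix.trace, Matrix.mul_apply]
    _ ≤ ∑ i, |∑ j, (M i j - N i j) * C j i| := Finset.abs_sum_le_sum_abs _ _
    _ = ∑ i ∈ ({u, v} : Finset V), |∑ j, (M i j - N i j) * C j i| :=
        (Finset.sum_subset (Finset.subset_univ _) fun i _ hi => hzero i hi).symm
    _ ≤ ∑ _i ∈ ({u, v} : Finset V), (2 : ℝ) := Finset.sum_le_sum fun i _ => hrow i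
    _ ≤ 4 := by
        rw [Finset.sum_const, nsmul_eq_mul]
        have : ((({u, v} : Finset V).card : ℕ) : ℝ) ≤ 2 := by exact_mod_cast Finset.card_le_two
        linarith

/-- Replacing two rows of a substochastic matrix changes the traces of its powers by a bounded
amount, by telescoping `M ^ k - N ^ k`. The factor `C` is there for the induction. -/
lemma abs_trace_mul_pow_sub_pow_le [DecidableEq V] {M N C : Matrix V V ℝ} (hM : IsSubstochastic M)
    (hN : IsSubstochastic N) (hC : IsSubstochastic C) {u v : V}
    (h : ∀ i, i ≠ u → i ≠ v → ∀ j, M i j = N i j) (k : ℕ) :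
    |(C * (M ^ k - N ^ k)).trace| ≤ 4 * k := by
  induction k generalizing C with
  | zero => simp
  | succ k ih =>
    have h1 : C * (M ^ (k + 1) - N ^ (k + 1)) =
        (C * M ^ k) * (M - N) + (C * (M ^ k - N ^ k)) * N := by
      rw [pow_succ, pow_succ]
      noncomm_ring
    rw [h1, Matrix.trace_add, Matrix.trace_mul_comm (C * (M ^ k - N ^ k)) N, ← mul_assoc]
    refine (abs_add_le _ _).trans ?_
    have h2 := abs_trace_mul_sub_le hM hN (hC.mul (hM.pow k)) h
    have h3 := ih (hN.mul hC)
    push_cast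
    linarith

end Substochastic

/-- The weight `c + d` of a vertex of degree `d` in the diagonal matrix `D`, which is `1` for an
isolated vertex. -/
noncomputable def vertexWeight (c : ℝ) (d : ℕ) : ℝ := if d = 0 then 1 else c + d

lemma one_le_vertexWeight {c : ℝ} (hc : 0 ≤ c) (d : ℕ) : 1 ≤ vertexWeight c d := by
  unfold vertexWeight
  split_ifs with h
  · exact le_rfl
  · have : (1 : ℝ) ≤ d := by exact_mod_cast Nat.one_le_iff_ne_zero.2 h
    linarith

lemma ndeg_congr {W : Type*} {G G' : SimpleGraph W} {u : W} (h : ∀ v, G.Adj u v ↔ G'.Adj u v) :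
    G.ndeg u = G'.ndeg u := by
  unfold SimpleGraph.ndeg
  congr 1
  ext v
  exact h v

/-- If the even power sums of finitely many real numbers are bounded, then the numbers lie
in `[-1, 1]`. -/
lemma abs_le_one_of_sum_pow_le {V : Type*} [Fintype V] {e : V → ℝ} {C : ℝ} (h : ∀ k, ∑ i, e i ^ (2 * k) ≤ C) (i : V) :
    |e i| ≤ 1 := by
  by_contra! hi
  have h1 : 1 < e i ^ 2 := by
    rw [← sq_abs]
    exact one_lt_pow₀ hi two_ne_zero
  obtain ⟨k, hk⟩ := pow_unbounded_of_one_lt C h1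
  have h2 : (e i ^ 2) ^ k ≤ ∑ j, e j ^ (2 * k) := by
    rw [← pow_mul]
    exact Finset.single_le_sum (f := fun j => e j ^ (2 * k))
      (fun j _ => (even_two_mul k).pow_nonneg _) (Finset.mem_univ i)
  linarith [h k]

lemma ndeg_eq_degree {V : Type*} [Fintype V] {G : SimpleGraph V} [DecidableRel G.Adj] (v : V) :
    G.ndeg v = G.degree v := by
  rw [SimpleGraph.ndeg, Set.ncard_eq_toFinset_card']
  rfl

lemma diagWeight_eq {V : Type*} [Fintype V] (c : ℝ) (G : SimpleGraph V) (v : V) :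
    diagWeight c G v = vertexWeight c (G.ndeg v) := by
  classical
  rw [ndeg_eq_degree]
  unfold diagWeight vertexWeight
  congr!

section KMatrix

variable {V : Type*} [Fintype V] [DecidableEq V] {c : ℝ}

lemma kMatrix_apply (G : SimpleGraph V) (u v : V) [Decidable (G.Adj u v)] :
    kMatrix c G u v = if G.Adj u v then (vertexWeight c (G.ndeg u))⁻¹ else 0 := by
  simp only [kMatrix, Matrix.diagonal_mul, SimpleGraph.adjMatrix_apply, mul_ite, mul_one, mul_zero,
    diagWeight_eq]

lemma isSubstochastic_kMatrix (hc : 0 ≤ c) (G : SimpleGraph V) :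
    IsSubstochastic (kMatrix c G) := by
  classical
  refine ⟨fun u v => ?_, fun u => ?_⟩
  · rw [kMatrix_apply]
    split_ifs
    · exact inv_nonneg.2 (zero_le_one.trans (one_le_vertexWeight hc _))
    · exact le_rfl
  · simp only [kMatrix_apply]
    rw [← Finset.sum_filter, Finset.sum_const, nsmul_eq_mul,
      ← SimpleGraph.neighborFinset_eq_filter, SimpleGraph.card_neighborFinset_eq_degree,
      ← ndeg_eq_degree, ← div_eq_mul_inv, div_le_one (zero_lt_one.trans_le
        (one_le_vertexWeight hc _))]
    unfold vertexWeight
    split_ifs with h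
    · simp [h]
    · linarith

/-- Adding an edge changes only two rows of `K`. -/
lemma abs_trace_kMatrix_pow_sub_le (hc : 0 ≤ c) (t : Finset (Sym2 V)) (e : Sym2 V) (k : ℕ) :
    |(kMatrix c (SimpleGraph.fromEdgeSet ((insert e t : Finset (Sym2 V)) : Set (Sym2 V))) ^ k).trace
      - (kMatrix c (SimpleGraph.fromEdgeSet (t : Set (Sym2 V))) ^ k).trace| ≤ 4 * k := by
  classical
  induction e with | h u v => ?_
  rw [← Matrix.trace_sub, ← one_mul (_ - _)]
  refine abs_trace_mul_pow_sub_pow_le (u := u) (v := v) (isSubstochastic_kMatrix hc _)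
    (isSubstochastic_kMatrix hc _) IsSubstochastic.one (fun i hu hv j => ?_) k
  have hadj : ∀ j, (SimpleGraph.fromEdgeSet
      ((insert s(u, v) t : Finset (Sym2 V)) : Set (Sym2 V))).Adj i j ↔
      (SimpleGraph.fromEdgeSet (t : Set (Sym2 V))).Adj i j := by
    intro j
    simp [SimpleGraph.fromEdgeSet_adj, hu, hv]
  rw [kMatrix_apply, kMatrix_apply, ndeg_congr hadj]
  exact if_congr (hadj j) rfl rfl

/-- The eigenvalues of `K`, listed with multiplicity: the matrix `D⁻¹ A` has the same
characteristic polynomial and the same traces of powers as `D^(-1/2) A D^(-1/2)`, which is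
symmetric. -/
lemma exists_eigenvalues_kMatrix (hc : 0 ≤ c) (G : SimpleGraph V) :
    ∃ e : V → ℝ, (kMatrix c G).charpoly.roots = Finset.univ.val.map e ∧
      ∀ k, (kMatrix c G ^ k).trace = ∑ i, e i ^ k := by
  classical
  set S : Matrix V V ℝ := Matrix.diagonal (fun v => Real.sqrt (diagWeight c G v)⁻¹) with hS
  have h1 : kMatrix c G = S * (S * G.adjMatrix ℝ) := by
    rw [← Matrix.mul_assoc, hS, Matrix.diagonal_mul_diagonal]
    unfold kMatrix
    congr 2
    · ext v
      exact (Real.mul_self_sqrt (inv_nonneg.2 (diagWeight_pos hc G v).le)).symm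
  set B : Matrix V V ℝ := S * G.adjMatrix ℝ with hB
  have hH : (B * S).IsHermitian := by
    rw [Matrix.IsHermitian, Matrix.conjTranspose_eq_transpose_of_trivial, hB, Matrix.transpose_mul,
      Matrix.transpose_mul, SimpleGraph.transpose_adjMatrix, hS, Matrix.diagonal_transpose,
      Matrix.mul_assoc]
  refine ⟨hH.eigenvalues, ?_, fun k => ?_⟩
  · rw [h1, Matrix.charpoly_mul_comm, hH.roots_charpoly_eq_eigenvalues]
    rfl
  · have h2 : (kMatrix c G ^ k).trace = ((B * S) ^ k).trace := by
      rw [h1]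
      cases k with
      | zero => simp
      | succ k =>
        rw [pow_succ, ← mul_assoc, mul_pow_mul, mul_assoc, Matrix.trace_mul_comm, mul_assoc,
          ← pow_succ]
    rw [h2]
    conv_lhs => rw [hH.spectral_theorem]
    rw [← map_pow, Unitary.conjStarAlgAut_apply, Matrix.trace_mul_comm, ← mul_assoc,
      Unitary.coe_star_mul_self, one_mul, Matrix.diagonal_pow, Matrix.trace_diagonal]
    simp

/-- The empirical spectral distribution of `K` is a normalized sum of point masses in `[-1, 1]`, and
its moments are normalized traces. -/
lemma exists_esd_kMatrix_eq (hc : 0 ≤ c) (G : SimpleGraph V) :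
    ∃ e : V → ℝ, esd (kMatrix c G) =
      (Fintype.card V : ℝ≥0∞)⁻¹ • ∑ i, Measure.dirac (e i) ∧
      (∀ k, (kMatrix c G ^ k).trace = ∑ i, e i ^ k) ∧ ∀ i, |e i| ≤ 1 := by
  obtain ⟨e, he, htr⟩ := exists_eigenvalues_kMatrix hc G
  refine ⟨e, ?_, htr, abs_le_one_of_sum_pow_le (C := Fintype.card V) fun k => ?_⟩
  · unfold esd
    rw [he, Multiset.map_map]
    rfl
  · rw [← htr]
    exact ((isSubstochastic_kMatrix hc G).pow _).trace_le

end KMatrix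

/-! ### Closed walks and their reduction -/

section Walks

variable {V : Type*}

/-- The product of the matrix entries along a sequence of indices. -/
def walkWeight {k : ℕ} (M : Matrix V V ℝ) (v : Fin (k + 1) → V) : ℝ :=
  ∏ i : Fin k, M (v i.castSucc) (v i.succ)

lemma walkWeight_nonneg {k : ℕ} {M : Matrix V V ℝ} (hM : ∀ i j, 0 ≤ M i j)
    (v : Fin (k + 1) → V) : 0 ≤ walkWeight M v :=
  Finset.prod_nonneg fun _ _ => hM _ _

lemma walkWeight_cons {k : ℕ} (M : Matrix V V ℝ) (a : V) (w : Fin (k + 1) → V) :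
    walkWeight M (Fin.cons a w : Fin (k + 2) → V) = M a (w 0) * walkWeight M w := by
  unfold walkWeight
  rw [Fin.prod_univ_succ]
  simp

lemma sum_eq_sum_cons [Fintype V] {k : ℕ} (F : (Fin (k + 1) → V) → ℝ) :
    ∑ v, F v = ∑ a, ∑ w : Fin k → V, F (Fin.cons a w) := by
  rw [← (Fin.consEquiv fun _ : Fin (k + 1) => V).sum_comp, Fintype.sum_prod_type]
  rfl

lemma pow_apply_eq_sum_walkWeight [Fintype V] [DecidableEq V] (M : Matrix V V ℝ) (k : ℕ) (a b : V) :
    (M ^ k) a b = ∑ w : Fin k → V, if (Fin.cons a w : Fin (k + 1) → V) (Fin.last k) = b then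
      walkWeight M (Fin.cons a w : Fin (k + 1) → V) else 0 := by
  induction k generalizing a with
  | zero => simp [walkWeight, Matrix.one_apply]
  | succ k ih =>
    rw [pow_succ', Matrix.mul_apply, sum_eq_sum_cons]
    refine Finset.sum_congr rfl fun u _ => ?_
    rw [ih, Finset.mul_sum]
    refine Finset.sum_congr rfl fun w _ => ?_
    rw [walkWeight_cons, mul_ite, mul_zero, ← Fin.succ_last]
    rfl

open scoped Classical in
/-- The weight of a closed walk, and `0` for a walk that is not closed. -/
noncomputable def closedWeight {k : ℕ} (M : Matrix V V ℝ) (v : Fin (k + 1) → V) : ℝ :=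
  if v 0 = v (Fin.last k) then walkWeight M v else 0

lemma trace_pow_eq_sum_closedWeight [Fintype V] [DecidableEq V] (M : Matrix V V ℝ) (k : ℕ) :
    (M ^ k).trace = ∑ v : Fin (k + 1) → V, closedWeight M v := by
  rw [sum_eq_sum_cons, Matrix.trace]
  refine Finset.sum_congr rfl fun a _ => ?_
  rw [Matrix.diag_apply, pow_apply_eq_sum_walkWeight]
  refine Finset.sum_congr rfl fun w _ => ?_
  simp only [closedWeight, Fin.cons_zero, eq_comm]

end Walks

lemma reachable_of_isChain {V : Type*} {T : SimpleGraph V} {b : V} {r : List V}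
    (h : (b :: r).IsChain T.Adj) {u : V} (hu : u ∈ b :: r) : T.Reachable b u := by
  induction r generalizing b with
  | nil => simp only [List.mem_singleton] at hu; rw [hu]
  | cons x r ih =>
    rw [List.isChain_cons_cons] at h
    rcases List.mem_cons.1 hu with rfl | hu
    · exact SimpleGraph.Reachable.refl _
    · exact h.1.reachable.trans (ih h.2 hu)

/-- In a forest, a path cannot be prolonged by a step back to one of its vertices, except by
retracing its last step. -/
lemma notMem_of_isAcyclic {V : Type*} {T : SimpleGraph V} (hT : T.IsAcyclic) {a b u : V} {r : List V}
    (hc : (a :: b :: r).IsChain T.Adj) (hn : (a :: b :: r).Nodup) (hau : T.Adj a u) (hub : u ≠ b) :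
    u ∉ a :: b :: r := by
  intro hu
  have hu' : u ∈ b :: r := (List.mem_cons.1 hu).resolve_left hau.ne'
  have ha : a ∉ b :: r := (List.nodup_cons.1 hn).1
  rw [List.isChain_cons_cons] at hc
  have hbr := SimpleGraph.isAcyclic_iff_forall_adj_isBridge.1 hT hau
  rw [SimpleGraph.isBridge_iff] at hbr
  refine hbr ?_
  have hab : (T.deleteEdges {s(a, u)}).Adj a b := by
    rw [SimpleGraph.deleteEdges_adj]
    refine ⟨hc.1, fun h => hub ?_⟩
    exact (Sym2.congr_right.1 (Set.mem_singleton_iff.1 h)).symm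
  refine hab.reachable.trans (reachable_of_isChain (r := r) ?_ hu')
  refine List.IsChain.imp_of_mem_imp ?_ hc.2
  intro x y hx hy hxy
  rw [SimpleGraph.deleteEdges_adj]
  refine ⟨hxy, fun h => ?_⟩
  have : a ∈ s(x, y) := by
    rw [Set.mem_singleton_iff.1 h]
    exact Sym2.mem_mk_left _ _
  rcases Sym2.mem_iff.1 this with rfl | rfl
  · exact ha hx
  · exact ha hy

section Reduction

variable {V : Type*} [DecidableEq V]

/-- One step of the reduction of a walk: the list holds the reduced walk so far, last vertex first,
and a step to `u` is cancelled against the preceding step if it retraces it. -/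
def reduceStep : List V → V → List V
  | a :: b :: r, u => if u = b then b :: r else u :: a :: b :: r
  | [a], u => [u, a]
  | [], u => [u]

/-- The list of vertices, in reverse order, of the walk obtained by cancelling backtracking
steps. It represents the endpoint of the lift of the walk to the universal cover. -/
def reduceWalk {k : ℕ} (v : Fin k → V) : List V := (List.ofFn v).foldl reduceStep []

lemma reduceStep_cons_cons (a b u : V) (r : List V) :
    reduceStep (a :: b :: r) u = if u = b then b :: r else u :: a :: b :: r := rfl

lemma exists_reduceStep_eq_cons (l : List V) (u : V) : ∃ r, reduceStep l u = u :: r := by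
  match l with
  | [] => exact ⟨_, rfl⟩
  | [a] => exact ⟨_, rfl⟩
  | a :: b :: r =>
    rw [reduceStep_cons_cons]
    split_ifs with h
    · exact ⟨r, by rw [h]⟩
    · exact ⟨_, rfl⟩

lemma getLast?_reduceStep {l : List V} (hl : l ≠ []) (u : V) :
    (reduceStep l u).getLast? = l.getLast? := by
  match l with
  | [] => exact absurd rfl hl
  | [a] => simp [reduceStep]
  | a :: b :: r =>
    rw [reduceStep_cons_cons]
    split_ifs <;> simp

lemma map_reduceStep {W : Type*} [DecidableEq W] (ι : V ↪ W) (l : List V) (u : V) :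
    reduceStep (l.map ι) (ι u) = (reduceStep l u).map ι := by
  match l with
  | [] => simp [reduceStep]
  | [a] => simp [reduceStep]
  | a :: b :: r =>
    simp only [reduceStep, List.map_cons, ι.injective.eq_iff]
    split_ifs <;> simp

lemma map_foldl_reduceStep {W : Type*} [DecidableEq W] (ι : V ↪ W) (w l : List V) :
    (w.map ι).foldl reduceStep (l.map ι) = (w.foldl reduceStep l).map ι := by
  induction w generalizing l with
  | nil => simp
  | cons u w ih => rw [List.map_cons, List.foldl_cons, List.foldl_cons, map_reduceStep, ih]

lemma length_reduceWalk_comp {W : Type*} [DecidableEq W] (ι : V ↪ W) {k : ℕ} (v : Fin k → V) :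
    (reduceWalk (ι ∘ v)).length = (reduceWalk v).length := by
  unfold reduceWalk
  have := map_foldl_reduceStep ι (List.ofFn v) []
  rw [List.map_nil, List.map_ofFn] at this
  rw [this, List.length_map]

lemma reduceStep_isChain_nodup {T : SimpleGraph V} (hT : T.IsAcyclic) {a u : V} {r : List V}
    (hc : (a :: r).IsChain T.Adj) (hn : (a :: r).Nodup) (hau : T.Adj a u) :
    (reduceStep (a :: r) u).IsChain T.Adj ∧ (reduceStep (a :: r) u).Nodup := by
  match r with
  | [] => simp [reduceStep, hau.symm, hau.ne']
  | b :: r =>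
    rw [reduceStep_cons_cons]
    split_ifs with h
    · exact ⟨(List.isChain_cons_cons.1 hc).2, (List.nodup_cons.1 hn).2⟩
    · exact ⟨List.isChain_cons_cons.2 ⟨hau.symm, hc⟩,
        List.nodup_cons.2 ⟨notMem_of_isAcyclic hT hc hn hau h, hn⟩⟩

/-- While a walk `a, w` in a forest is reduced, starting from the reduced walk `a :: r`, the reduced
walk stays a path; it keeps its starting point and ends where the walk ends. -/
lemma foldl_reduceStep_of_isAcyclic {T : SimpleGraph V} (hT : T.IsAcyclic) {a : V} {r w : List V}
    (hc : (a :: r).IsChain T.Adj) (hn : (a :: r).Nodup) (hw : (a :: w).IsChain T.Adj) :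
    (w.foldl reduceStep (a :: r)).Nodup ∧
      (w.foldl reduceStep (a :: r)).head? = (a :: w).getLast? ∧
      (w.foldl reduceStep (a :: r)).getLast? = (a :: r).getLast? := by
  induction w generalizing a r with
  | nil => exact ⟨hn, by simp, rfl⟩
  | cons u w ih =>
    rw [List.isChain_cons_cons] at hw
    rw [List.foldl_cons]
    obtain ⟨h1, h2⟩ := reduceStep_isChain_nodup hT hc hn hw.1
    have h3 := getLast?_reduceStep (List.cons_ne_nil a r) u
    obtain ⟨r', hr'⟩ := exists_reduceStep_eq_cons (a :: r) u
    rw [hr'] at h1 h2 h3 ⊢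
    obtain ⟨h4, h5, h6⟩ := ih h1 h2 hw.2
    exact ⟨h4, by rw [h5]; simp, by rw [h6, h3]⟩

/-- A closed walk in a forest reduces to the trivial walk. -/
lemma length_reduceWalk_of_isAcyclic {T : SimpleGraph V} (hT : T.IsAcyclic) {k : ℕ}
    {v : Fin (k + 1) → V} (hv : ∀ i : Fin k, T.Adj (v i.castSucc) (v i.succ))
    (hcl : v 0 = v (Fin.last k)) : (reduceWalk v).length = 1 := by
  have hchain : (List.ofFn v).IsChain T.Adj := by
    rw [List.isChain_iff_getElem]
    intro i hi
    rw [List.length_ofFn] at hi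
    rw [List.getElem_ofFn, List.getElem_ofFn]
    exact hv ⟨i, by omega⟩
  have hlast : (List.ofFn v).getLast? = some (v (Fin.last k)) := by
    rw [List.getLast?_eq_getElem?, List.length_ofFn, Nat.add_sub_cancel,
      List.getElem?_eq_getElem (by simp), List.getElem_ofFn]
    rfl
  have hsucc : List.ofFn v = v 0 :: List.ofFn (fun i : Fin k => v i.succ) := List.ofFn_succ
  rw [hsucc] at hchain hlast
  obtain ⟨h1, h2, h3⟩ := foldl_reduceStep_of_isAcyclic hT (List.isChain_singleton (v 0))
    (List.nodup_singleton (v 0)) hchain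
  have h4 : reduceWalk v =
      (List.ofFn fun i : Fin k => v i.succ).foldl reduceStep [v 0] := by
    unfold reduceWalk
    rw [hsucc, List.foldl_cons]
    rfl
  rw [← h4] at h1 h2 h3
  rw [hlast, ← hcl] at h2
  match hl : reduceWalk v with
  | [] => rw [hl] at h2; simp at h2
  | [x] => rfl
  | x :: y :: r =>
    rw [hl] at h1 h2 h3
    simp only [List.head?_cons, Option.some.injEq] at h2
    subst h2
    rw [List.getLast?_cons_cons] at h3
    have := List.mem_of_getLast? h3
    rw [List.getLast?_singleton] at h3
    exact absurd (List.mem_of_getLast? h3) (List.nodup_cons.1 h1).1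

end Reduction

lemma tau_pos {c : ℝ} (hc : 0 ≤ c) : 0 < tau c := by
  unfold tau
  positivity

lemma tau_sq {c : ℝ} (hc : 0 ≤ c) : tau c ^ 2 * (1 + c) = 1 := by
  unfold tau
  rw [div_pow, Real.sq_sqrt (by linarith)]
  field_simp

section Superharmonic

variable {V : Type*} [Fintype V] [DecidableEq V] {c : ℝ}

/-- On a tree rooted at one of its vertices, the function `τ ^ depth` satisfies `K f ≤ τ f`, since a
vertex has at most one neighbour of smaller depth; here the tree is the universal cover of `G`,
whose vertices are the reduced walks. -/
lemma sum_kMatrix_mul_tau_pow_le (hc : 0 ≤ c) (G : SimpleGraph V) (a : V) (r : List V) :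
    ∑ u, kMatrix c G a u * tau c ^ (reduceStep (a :: r) u).length ≤
      tau c * tau c ^ (a :: r).length := by
  classical
  have hτ := tau_pos hc
  have hτ2 := tau_sq hc
  have hw : 0 < vertexWeight c (G.ndeg a) := zero_lt_one.trans_le (one_le_vertexWeight hc _)
  -- a step back to the parent gains `τ ^ (depth - 1) - τ ^ (depth + 1) = c τ ^ (depth + 1)` over a
  -- step away from the root
  have hstep : ∀ u, tau c ^ (reduceStep (a :: r) u).length ≤
      tau c ^ (r.length + 2) + if r.head? = some u then c * tau c ^ (r.length + 2) else 0 := by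
    intro u
    match r with
    | [] => simp [reduceStep]
    | b :: r =>
      rw [reduceStep_cons_cons]
      by_cases h : u = b
      · subst h
        rw [if_pos rfl, List.head?_cons, if_pos rfl]
        simp only [List.length_cons]
        have : tau c ^ (r.length + 1) = tau c ^ (r.length + 1) * (tau c ^ 2 * (1 + c)) := by
          rw [hτ2, mul_one]
        rw [this]
        exact le_of_eq (by ring)
      · rw [if_neg h, List.head?_cons, if_neg (by simpa using Ne.symm h)]
        simp
  have hdeg : (∑ u, if G.Adj a u then (1 : ℝ) else 0) = G.ndeg a := by
    rw [← Finset.sum_filter, Finset.sum_const, nsmul_eq_mul, mul_one,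
      ← SimpleGraph.neighborFinset_eq_filter, SimpleGraph.card_neighborFinset_eq_degree,
      ndeg_eq_degree]
  by_cases h0 : G.ndeg a = 0
  · have : ∀ u, kMatrix c G a u = 0 := by
      intro u
      rw [kMatrix_apply, if_neg]
      intro hau
      rw [SimpleGraph.ndeg, Set.ncard_eq_zero] at h0
      exact (Set.eq_empty_iff_forall_notMem.1 h0) u hau
    simp only [this, zero_mul, Finset.sum_const_zero]
    positivity
  have hone : (∑ u, if r.head? = some u then c * tau c ^ (r.length + 2) else 0) ≤
      c * tau c ^ (r.length + 2) := by
    cases hr : r.head? with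
    | none => simp; positivity
    | some b => simp
  calc ∑ u, kMatrix c G a u * tau c ^ (reduceStep (a :: r) u).length
      ≤ ∑ u, (vertexWeight c (G.ndeg a))⁻¹ * ((if G.Adj a u then 1 else 0) *
          tau c ^ (r.length + 2) + if r.head? = some u then c * tau c ^ (r.length + 2) else 0) := by
        refine Finset.sum_le_sum fun u _ => ?_
        rw [kMatrix_apply]
        have hnn : 0 ≤ if r.head? = some u then c * tau c ^ (r.length + 2) else 0 := by
          split_ifs
          · positivity
          · exact le_rfl
        by_cases hau : G.Adj a u
        · rw [if_pos hau, if_pos hau, one_mul]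
          exact mul_le_mul_of_nonneg_left (hstep u) (inv_nonneg.2 hw.le)
        · rw [if_neg hau, if_neg hau, zero_mul, zero_mul, zero_add]
          positivity
    _ = (vertexWeight c (G.ndeg a))⁻¹ * (G.ndeg a * tau c ^ (r.length + 2) +
          ∑ u, if r.head? = some u then c * tau c ^ (r.length + 2) else 0) := by
        rw [← Finset.mul_sum, Finset.sum_add_distrib, ← Finset.sum_mul, hdeg]
    _ ≤ (vertexWeight c (G.ndeg a))⁻¹ * (G.ndeg a * tau c ^ (r.length + 2) +
          c * tau c ^ (r.length + 2)) :=
        mul_le_mul_of_nonneg_left (by linarith) (inv_nonneg.2 hw.le)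
    _ = (vertexWeight c (G.ndeg a))⁻¹ * (vertexWeight c (G.ndeg a) * tau c ^ (r.length + 2)) := by
        rw [vertexWeight, if_neg h0]
        ring
    _ = tau c * tau c ^ (a :: r).length := by
        rw [inv_mul_cancel_left₀ hw.ne', List.length_cons]
        ring

/-- Iterating `K f ≤ τ f` for the function `f = τ ^ depth` on the universal cover. The depth is
measured here by the number of vertices of the reduced walk. -/
lemma sum_walkWeight_mul_tau_pow_le (hc : 0 ≤ c) (G : SimpleGraph V) (k : ℕ) (a : V)
    (r : List V) :
    ∑ w : Fin k → V, walkWeight (kMatrix c G) (Fin.cons a w : Fin (k + 1) → V) *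
      tau c ^ ((List.ofFn w).foldl reduceStep (a :: r)).length ≤
      tau c ^ k * tau c ^ (a :: r).length := by
  induction k generalizing a r with
  | zero => simp [walkWeight]
  | succ k ih =>
    have hτ := tau_pos hc
    rw [sum_eq_sum_cons]
    calc _ = ∑ u, kMatrix c G a u * ∑ w : Fin k → V,
          walkWeight (kMatrix c G) (Fin.cons u w : Fin (k + 1) → V) *
            tau c ^ ((List.ofFn w).foldl reduceStep (reduceStep (a :: r) u)).length := by
          refine Finset.sum_congr rfl fun u _ => ?_
          rw [Finset.mul_sum]
          refine Finset.sum_congr rfl fun w _ => ?_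
          rw [walkWeight_cons, Fin.cons_zero, List.ofFn_cons, List.foldl_cons, mul_assoc]
      _ ≤ ∑ u, kMatrix c G a u * (tau c ^ k * tau c ^ (reduceStep (a :: r) u).length) := by
          refine Finset.sum_le_sum fun u _ =>
            mul_le_mul_of_nonneg_left ?_ ((isSubstochastic_kMatrix hc G).1 _ _)
          obtain ⟨r', hr'⟩ := exists_reduceStep_eq_cons (a :: r) u
          rw [hr']
          exact ih u r'
      _ = tau c ^ k * ∑ u, kMatrix c G a u * tau c ^ (reduceStep (a :: r) u).length := by
          rw [Finset.mul_sum]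
          exact Finset.sum_congr rfl fun u _ => by ring
      _ ≤ tau c ^ k * (tau c * tau c ^ (a :: r).length) :=
          mul_le_mul_of_nonneg_left (sum_kMatrix_mul_tau_pow_le hc G a r) (by positivity)
      _ = tau c ^ (k + 1) * tau c ^ (a :: r).length := by ring

/-- The closed walks that reduce to the trivial walk have at most the total weight they would have
on a tree. -/
lemma sum_closedWeight_reduceWalk_le (hc : 0 ≤ c) (G : SimpleGraph V) (k : ℕ) :
    ∑ v : Fin (k + 1) → V, (if (reduceWalk v).length = 1 then closedWeight (kMatrix c G) v else 0) ≤
      Fintype.card V * tau c ^ k := by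
  have hτ := tau_pos hc
  rw [sum_eq_sum_cons, ← mul_le_mul_iff_left₀ hτ]
  have : ∀ a : V, (∑ w : Fin k → V,
      if (reduceWalk (Fin.cons a w : Fin (k + 1) → V)).length = 1 then
        closedWeight (kMatrix c G) (Fin.cons a w : Fin (k + 1) → V) else 0) * tau c ≤
      tau c ^ k * tau c := by
    intro a
    have h1 := sum_walkWeight_mul_tau_pow_le hc G k a []
    rw [List.length_singleton, pow_one] at h1
    refine le_trans ?_ h1
    rw [Finset.sum_mul]
    refine Finset.sum_le_sum fun w _ => ?_
    have h2 := walkWeight_nonneg (isSubstochastic_kMatrix hc G).1 (Fin.cons a w : Fin (k + 1) → V)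
    have h3 : reduceWalk (Fin.cons a w : Fin (k + 1) → V) =
        (List.ofFn w).foldl reduceStep [a] := by
      unfold reduceWalk
      rw [List.ofFn_cons, List.foldl_cons]
      rfl
    rw [← h3]
    split_ifs with h
    · rw [h, pow_one]
      refine mul_le_mul_of_nonneg_right ?_ hτ.le
      unfold closedWeight
      split_ifs
      · exact le_rfl
      · exact h2
    · rw [zero_mul]
      positivity
  rw [Finset.sum_mul]
  refine (Finset.sum_le_sum fun a _ => this a).trans_eq ?_
  rw [Finset.sum_const, Finset.card_univ, nsmul_eq_mul, mul_assoc]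

end Superharmonic

/-! ### Convergence of the mean moments -/

lemma graphMean_congr {V : Type*} [Fintype V] [DecidableEq V] {p : ℝ} {F F' : SimpleGraph V → ℝ}
    (h : ∀ G, F G = F' G) : graphMean p F = graphMean p F' :=
  bernoulliMean_congr fun _ _ => h _

lemma graphMean_sum {V β : Type*} [Fintype V] [DecidableEq V] {p : ℝ} (u : Finset β)
    (F : β → SimpleGraph V → ℝ) :
    graphMean p (fun G => ∑ b ∈ u, F b G) = ∑ b ∈ u, graphMean p (F b) :=
  bernoulliMean_sum _ _

lemma graphMean_const_mul {V : Type*} [Fintype V] [DecidableEq V] {p : ℝ} (C : ℝ)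
    (F : SimpleGraph V → ℝ) : graphMean p (fun G => C * F G) = C * graphMean p F :=
  bernoulliMean_const_mul C

lemma graphMean_zero {V : Type*} [Fintype V] [DecidableEq V] {p : ℝ} :
    graphMean p (fun _ : SimpleGraph V => 0) = 0 :=
  bernoulliMean_const 0

lemma graphMean_mono {V : Type*} [Fintype V] [DecidableEq V] {p : ℝ} (hp0 : 0 ≤ p) (hp1 : p ≤ 1)
    {F F' : SimpleGraph V → ℝ} (h : ∀ G, F G ≤ F' G) : graphMean p F ≤ graphMean p F' :=
  bernoulliMean_mono hp0 hp1 fun _ _ => h _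

lemma graphMean_const {V : Type*} [Fintype V] [DecidableEq V] {p : ℝ} (C : ℝ) :
    graphMean p (fun _ : SimpleGraph V => C) = C :=
  bernoulliMean_const C

section Setoid

instance {A : Type*} [Finite A] : Finite (Setoid A) :=
  Finite.of_injective (fun S : Setoid A => S.r) fun S T h => by
    ext x y
    exact iff_of_eq (congrFun (congrFun h x) y)

noncomputable instance {A : Type*} [Finite A] : Fintype (Setoid A) := Fintype.ofFinite _

open scoped Classical in
/-- Every function on `A` factors uniquely as the projection to a quotient of `A`, followed by
an injection. -/
lemma sum_eq_sum_setoid {A V : Type*} [Fintype A] [DecidableEq A] [Fintype V] (F : (A → V) → ℝ) :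
    ∑ v, F v = ∑ S : Setoid A, ∑ ι : Quotient S ↪ V, F (ι ∘ Quotient.mk S) := by
  rw [← Fintype.sum_sigma' (fun (S : Setoid A) (ι : Quotient S ↪ V) => F (ι ∘ Quotient.mk S))]
  symm
  refine Function.Bijective.sum_comp
    (e := fun x : (S : Setoid A) × (Quotient S ↪ V) => x.2 ∘ Quotient.mk x.1) ⟨?_, ?_⟩ F
  · rintro ⟨S, ι⟩ ⟨S', ι'⟩ h
    have hS : S = S' := by
      ext x y
      have h1 : ∀ z, ι (Quotient.mk S z) = ι' (Quotient.mk S' z) := fun z => congrFun h z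
      calc S x y ↔ Quotient.mk S x = Quotient.mk S y := Quotient.eq.symm
        _ ↔ ι (Quotient.mk S x) = ι (Quotient.mk S y) := ι.injective.eq_iff.symm
        _ ↔ ι' (Quotient.mk S' x) = ι' (Quotient.mk S' y) := by rw [h1, h1]
        _ ↔ Quotient.mk S' x = Quotient.mk S' y := ι'.injective.eq_iff
        _ ↔ S' x y := Quotient.eq
    subst hS
    congr
    ext q
    induction q using Quotient.inductionOn with | h x => exact congrFun h x
  · intro v
    exact ⟨⟨Setoid.ker v, ⟨Setoid.kerLift v, Setoid.kerLift_injective v⟩⟩, rfl⟩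

end Setoid

lemma closedWeight_of_eq {V : Type*} {k : ℕ} {M : Matrix V V ℝ} {v : Fin (k + 1) → V}
    (h : v 0 = v (Fin.last k)) : closedWeight M v = walkWeight M v :=
  if_pos h

lemma closedWeight_of_ne {V : Type*} {k : ℕ} {M : Matrix V V ℝ} {v : Fin (k + 1) → V}
    (h : v 0 ≠ v (Fin.last k)) : closedWeight M v = 0 :=
  if_neg h

section TraceGraph

variable {Q : Type*} {k : ℕ}

/-- The graph formed by the steps of a walk. -/
def traceGraph (π : Fin (k + 1) → Q) : SimpleGraph Q :=
  SimpleGraph.fromEdgeSet (Set.range fun i : Fin k => s(π i.castSucc, π i.succ))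

lemma traceGraph_adj_step {π : Fin (k + 1) → Q} {i : Fin k} (h : π i.castSucc ≠ π i.succ) :
    (traceGraph π).Adj (π i.castSucc) (π i.succ) :=
  (SimpleGraph.fromEdgeSet_adj _).2 ⟨⟨i, rfl⟩, h⟩

lemma connected_traceGraph {π : Fin (k + 1) → Q} (hπ : Function.Surjective π) :
    (traceGraph π).Connected := by
  have h0 : ∀ i, (traceGraph π).Reachable (π 0) (π i) := by
    intro i
    induction i using Fin.induction with
    | zero => exact SimpleGraph.Reachable.refl _
    | succ i ih =>
      by_cases h : π i.castSucc = π i.succ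
      · rwa [← h]
      · exact ih.trans (traceGraph_adj_step h).reachable
  have : Nonempty Q := ⟨π 0⟩
  refine ⟨fun x y => ?_⟩
  obtain ⟨i, rfl⟩ := hπ x
  obtain ⟨j, rfl⟩ := hπ y
  exact (h0 i).symm.trans (h0 j)

lemma map_traceGraph_le_iff {V : Type*} {π : Fin (k + 1) → Q}
    (hπ : ∀ i : Fin k, π i.castSucc ≠ π i.succ) (ι : Q ↪ V) (G : SimpleGraph V) :
    (traceGraph π).map ι ≤ G ↔ ∀ i : Fin k, G.Adj (ι (π i.castSucc)) (ι (π i.succ)) := by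
  constructor
  · intro h i
    exact h ((SimpleGraph.map_adj _ _ _ _).2 ⟨_, _, traceGraph_adj_step (hπ i), rfl, rfl⟩)
  · intro h x y hxy
    obtain ⟨a, b, hab, rfl, rfl⟩ := (SimpleGraph.map_adj _ _ _ _).1 hxy
    obtain ⟨⟨i, hi⟩, -⟩ := (SimpleGraph.fromEdgeSet_adj _).1 hab
    rcases Sym2.eq_iff.1 hi with ⟨rfl, rfl⟩ | ⟨rfl, rfl⟩
    · exact h i
    · exact (h i).symm

open scoped Classical in
lemma walkWeight_kMatrix_comp {V : Type*} [Fintype V] [DecidableEq V] [Fintype Q] {c : ℝ}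
    {π : Fin (k + 1) → Q} (hπ : ∀ i : Fin k, π i.castSucc ≠ π i.succ) (ι : Q ↪ V)
    (G : SimpleGraph V) :
    walkWeight (kMatrix c G) (ι ∘ π) = if (traceGraph π).map ι ≤ G then
      ∏ q, (vertexWeight c (G.ndeg (ι q)))⁻¹ ^
        (Finset.univ.filter fun i : Fin k => π i.castSucc = q).card else 0 := by
  unfold walkWeight
  simp only [map_traceGraph_le_iff hπ, kMatrix_apply, Function.comp_apply]
  rw [Finset.prod_ite_zero]
  by_cases h : ∀ i : Fin k, G.Adj (ι (π i.castSucc)) (ι (π i.succ))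
  swap
  · rw [if_neg h, if_neg (by simpa using h)]
  rw [if_pos h, if_pos (by simpa using h)]
  rw [← Finset.prod_fiberwise Finset.univ (fun i : Fin k => π i.castSucc)]
  refine Finset.prod_congr rfl fun q _ => ?_
  rw [Finset.prod_congr rfl fun i hi => by rw [(Finset.mem_filter.1 hi).2], Finset.prod_const]

end TraceGraph

/-- The normalized mean weight of the closed walks with a given pattern of coincidences converges,
and the limit vanishes unless the pattern reduces to the trivial walk: otherwise the walk goes
around a cycle, and cycles of bounded length are rare. -/
lemma exists_tendsto_mean_closedWeight {c p : ℝ} (hc : 0 ≤ c) (hp : 0 < p) {k : ℕ} {Q : Type}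
    [Fintype Q] [DecidableEq Q] {π : Fin (k + 1) → Q} (hπ : Function.Surjective π) :
    ∃ L, Tendsto (fun n : ℕ => (n : ℝ)⁻¹ * ∑ ι : Q ↪ Fin n, graphMean (p / n)
        (fun G => closedWeight (kMatrix c G) (ι ∘ π))) atTop (𝓝 L) ∧
      ((reduceWalk π).length ≠ 1 → L = 0) := by
  classical
  by_cases hcl : π 0 = π (Fin.last k)
  · by_cases hloop : ∀ i : Fin k, π i.castSucc ≠ π i.succ
    · have hconn := connected_traceGraph hπ
      have hcard := hconn.card_vert_le_card_edgeSet_add_one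
      rw [Nat.card_eq_fintype_card, Nat.card_coe_set_eq] at hcard
      have hw : ∀ d, 0 < vertexWeight c d := fun d =>
        zero_lt_one.trans_le (one_le_vertexWeight hc d)
      have hlim := tendsto_mean_placements (traceGraph π) hcard (p := p)
        (φ := fun q d => (vertexWeight c d)⁻¹ ^
          (Finset.univ.filter fun i : Fin k => π i.castSucc = q).card)
        (fun q d => pow_nonneg (inv_nonneg.2 (hw d).le) _)
        (fun q d => pow_le_one₀ (inv_nonneg.2 (hw d).le)
          (inv_le_one_of_one_le₀ (one_le_vertexWeight hc d))) hp
      refine ⟨_, hlim.congr fun n => ?_, fun hred => ?_⟩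
      · congr 1
        refine Finset.sum_congr rfl fun ι _ => graphMean_congr fun G => ?_
        rw [closedWeight_of_eq (congrArg ι hcl), walkWeight_kMatrix_comp hloop]
        congr!
      · rw [if_neg, zero_mul]
        intro heq
        -- a connected graph with one vertex more than edges is a tree
        refine hred (length_reduceWalk_of_isAcyclic (T := traceGraph π) ?_
          (fun i => traceGraph_adj_step (hloop i)) hcl)
        refine (SimpleGraph.isTree_iff_connected_and_card.2 ⟨hconn, ?_⟩).isAcyclic
        rw [Nat.card_coe_set_eq, Nat.card_eq_fintype_card, heq]
    · -- a pattern with a step that stays in place has weight zero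
      push Not at hloop
      obtain ⟨i, hi⟩ := hloop
      refine ⟨0, ?_, fun _ => rfl⟩
      have : ∀ (n : ℕ) (ι : Q ↪ Fin n) (G : SimpleGraph (Fin n)),
          closedWeight (kMatrix c G) (ι ∘ π) = 0 := by
        intro n ι G
        rw [closedWeight_of_eq (congrArg ι hcl)]
        refine Finset.prod_eq_zero (Finset.mem_univ i) ?_
        rw [kMatrix_apply, if_neg]
        rw [Function.comp_apply, Function.comp_apply, hi]
        exact G.irrefl
      simp only [this, graphMean_zero, Finset.sum_const_zero, mul_zero]
      exact tendsto_const_nhds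
  · refine ⟨0, ?_, fun _ => rfl⟩
    have : ∀ (n : ℕ) (ι : Q ↪ Fin n) (G : SimpleGraph (Fin n)),
        closedWeight (kMatrix c G) (ι ∘ π) = 0 := by
      intro n ι G
      exact closedWeight_of_ne fun h => hcl (ι.injective h)
    simp only [this, graphMean_zero, Finset.sum_const_zero, mul_zero]
    exact tendsto_const_nhds

lemma eventually_div_mem_unitInterval {p : ℝ} (hp : 0 < p) :
    ∀ᶠ n : ℕ in atTop, 0 < (n : ℝ) ∧ 0 ≤ p / n ∧ p / n ≤ 1 := by
  filter_upwards [eventually_ge_atTop (⌈p⌉₊ + 1)] with n hn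
  have hpn : p ≤ n := (Nat.le_ceil p).trans (by exact_mod_cast (Nat.le_succ _).trans hn)
  have hpos : (0 : ℝ) < n := hp.trans_le hpn
  exact ⟨hpos, by positivity, (div_le_one hpos).2 hpn⟩

open scoped Classical in
lemma exists_tendsto_mean_closedWeight_quotient {c p : ℝ} (hc : 0 ≤ c) (hp : 0 < p) {k : ℕ}
    (S : Setoid (Fin (k + 1))) :
    ∃ L, Tendsto (fun n : ℕ => (n : ℝ)⁻¹ * ∑ ι : Quotient S ↪ Fin n, graphMean (p / n)
        (fun G => closedWeight (kMatrix c G) (ι ∘ Quotient.mk S))) atTop (𝓝 L) ∧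
      ((reduceWalk (Quotient.mk S)).length ≠ 1 → L = 0) :=
  exists_tendsto_mean_closedWeight hc hp Quotient.mk_surjective

open scoped Classical in
/-- The mean normalized traces of the powers of `K` converge, and the limits obey the bound `τ ^ k`
that holds on trees. -/
lemma exists_tendsto_mean_trace_pow {c p : ℝ} (hc : 0 ≤ c) (hp : 0 < p) (k : ℕ) :
    ∃ m, Tendsto (fun n : ℕ => (n : ℝ)⁻¹ *
        graphMean (p / n) (fun G : SimpleGraph (Fin n) => (kMatrix c G ^ k).trace)) atTop (𝓝 m) ∧
      m ≤ tau c ^ k := by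
  choose L hL hL0 using fun S : Setoid (Fin (k + 1)) =>
    exists_tendsto_mean_closedWeight_quotient hc hp S
  refine ⟨∑ S, L S, ?_, ?_⟩
  · refine (tendsto_finsetSum _ fun S _ => hL S).congr fun n => ?_
    rw [← Finset.mul_sum]
    congr 1
    simp only [trace_pow_eq_sum_closedWeight, graphMean_sum]
    exact (sum_eq_sum_setoid fun v : Fin (k + 1) → Fin n => graphMean (p / n) fun G =>
      closedWeight (kMatrix c G) v).symm
  · -- the walks that do not reduce to the trivial walk do not contribute to the limit
    have hlim : Tendsto (fun n : ℕ => (n : ℝ)⁻¹ * graphMean (p / n)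
        (fun G : SimpleGraph (Fin n) => ∑ v : Fin (k + 1) → Fin n,
          if (reduceWalk v).length = 1 then closedWeight (kMatrix c G) v else 0)) atTop
        (𝓝 (∑ S, L S)) := by
      have : ∀ S, Tendsto (fun n : ℕ => if (reduceWalk (Quotient.mk S)).length = 1 then
          (n : ℝ)⁻¹ * ∑ ι : Quotient S ↪ Fin n, graphMean (p / n)
            (fun G => closedWeight (kMatrix c G) (ι ∘ Quotient.mk S)) else 0) atTop (𝓝 (L S)) := by
        intro S
        by_cases hS : (reduceWalk (Quotient.mk S)).length = 1
        · simpa only [if_pos hS] using hL S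
        · simp only [if_neg hS, hL0 S hS]
          exact tendsto_const_nhds
      refine (tendsto_finsetSum _ fun S _ => this S).congr fun n => ?_
      rw [graphMean_sum, sum_eq_sum_setoid (fun v : Fin (k + 1) → Fin n => graphMean (p / n)
        fun G => if (reduceWalk v).length = 1 then closedWeight (kMatrix c G) v else 0),
        Finset.mul_sum]
      refine Finset.sum_congr rfl fun S _ => ?_
      simp only [length_reduceWalk_comp]
      split_ifs with hS
      · rfl
      · simp only [graphMean_zero, Finset.sum_const_zero, mul_zero]
    refine le_of_tendsto hlim ?_
    filter_upwards [eventually_div_mem_unitInterval hp] with n hn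
    rw [inv_mul_le_iff₀ hn.1]
    calc _ ≤ graphMean (p / n) (fun _ : SimpleGraph (Fin n) => (n : ℝ) * tau c ^ k) := by
          refine graphMean_mono hn.2.1 hn.2.2 fun G => ?_
          have := sum_closedWeight_reduceWalk_le hc G k
          rwa [Fintype.card_fin] at this
      _ = _ := graphMean_const _

/-! ### Star components -/

section Star

/-- The star with center `none` and `m` leaves. -/
def starOption (m : ℕ) : SimpleGraph (Option (Fin m)) :=
  SimpleGraph.fromEdgeSet (Set.range fun i : Fin m => s(none, some i))

lemma starOption_adj_none {m : ℕ} (x : Option (Fin m)) :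
    (starOption m).Adj none x ↔ x ≠ none := by
  rw [starOption, SimpleGraph.fromEdgeSet_adj]
  cases x <;> simp

lemma starOption_adj_some {m : ℕ} (i : Fin m) (x : Option (Fin m)) :
    (starOption m).Adj (some i) x ↔ x = none := by
  rw [starOption, SimpleGraph.fromEdgeSet_adj]
  cases x <;> simp

lemma ndeg_starOption_none (m : ℕ) : (starOption m).ndeg none = m := by
  have : (starOption m).neighborSet none = some '' Set.univ := by
    ext x
    rw [SimpleGraph.mem_neighborSet, starOption_adj_none]
    cases x <;> simp
  rw [SimpleGraph.ndeg, this, Set.ncard_image_of_injective _ (Option.some_injective _),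
    Set.ncard_univ, Nat.card_eq_fintype_card, Fintype.card_fin]

lemma ndeg_starOption_some {m : ℕ} (i : Fin m) : (starOption m).ndeg (some i) = 1 := by
  have : (starOption m).neighborSet (some i) = {none} := by
    ext x
    rw [SimpleGraph.mem_neighborSet, starOption_adj_some]
    rfl
  rw [SimpleGraph.ndeg, this, Set.ncard_singleton]

lemma ncard_edgeSet_starOption (m : ℕ) : (starOption m).edgeSet.ncard = m := by
  have hinj : Function.Injective fun i : Fin m => s((none : Option (Fin m)), some i) :=
    fun i j h => Option.some_injective _ (Sym2.congr_right.1 h)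
  have : (starOption m).edgeSet = (fun i : Fin m => s((none : Option (Fin m)), some i)) ''
      Set.univ := by
    rw [starOption, SimpleGraph.edgeSet_fromEdgeSet, Set.image_univ]
    refine sdiff_eq_left.2 (Set.disjoint_left.2 ?_)
    rintro _ ⟨i, rfl⟩ h
    simp at h
  rw [this, Set.ncard_image_of_injective _ hinj, Set.ncard_univ, Nat.card_eq_fintype_card,
    Fintype.card_fin]

/-- The degrees of the vertices of a star with `m` leaves. -/
def starDegree (m : ℕ) : Option (Fin m) → ℕ
  | none => m
  | some _ => 1

lemma poissonMean_indicator_zero (p : ℝ) (a : ℕ) :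
    poissonMean p (fun d => if a + d = a then (1 : ℝ) else 0) = Real.exp (-p) := by
  unfold poissonMean
  rw [tsum_eq_single 0]
  · simp
  · intro d hd
    simp [hd]

open scoped Classical in
/-- The mean number of star components with `m` leaves is of order `n`. -/
lemma exists_tendsto_mean_star {p : ℝ} (hp : 0 < p) (m : ℕ) :
    ∃ δ : ℝ, 0 < δ ∧ Tendsto (fun n : ℕ => (n : ℝ)⁻¹ * ∑ ι : Option (Fin m) ↪ Fin n,
      graphMean (p / n) (fun G => if (starOption m).map ι ≤ G then
        ∏ q, (if G.ndeg (ι q) = starDegree m q then (1 : ℝ) else 0) else 0)) atTop (𝓝 δ) := by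
  have hcard : Fintype.card (Option (Fin m)) = (starOption m).edgeSet.ncard + 1 := by
    rw [ncard_edgeSet_starOption]
    simp
  have h := tendsto_mean_placements (starOption m) hcard.le (p := p)
    (φ := fun q d => if d = starDegree m q then (1 : ℝ) else 0)
    (fun q d => by split_ifs <;> norm_num) (fun q d => by split_ifs <;> norm_num) hp
  refine ⟨_, ?_, h⟩
  rw [if_pos hcard]
  refine mul_pos (pow_pos hp _) (Finset.prod_pos fun q _ => ?_)
  have : (starOption m).ndeg q = starDegree m q := by
    cases q with
    | none => exact ndeg_starOption_none m
    | some i => exact ndeg_starOption_some i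
  rw [this, poissonMean_indicator_zero]
  exact Real.exp_pos _

variable {V : Type*} [Fintype V]

open scoped Classical in
/-- The centers of the components that are stars with `m` leaves. -/
noncomputable def starCenters (m : ℕ) (G : SimpleGraph V) : Finset V :=
  Finset.univ.filter fun o => G.ndeg o = m ∧ ∀ v, G.Adj o v → G.ndeg v = 1

lemma exists_eq_some_of_adj {m : ℕ} {G : SimpleGraph V} {ι : Option (Fin m) ↪ V}
    (hι : (starOption m).map ι ≤ G) (hdeg : G.ndeg (ι none) = m) {v : V}
    (hv : G.Adj (ι none) v) : ∃ i, ι (some i) = v := by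
  have hsub : Set.range (fun i => ι (some i)) ⊆ G.neighborSet (ι none) := by
    rintro _ ⟨i, rfl⟩
    exact hι ((SimpleGraph.map_adj _ _ _ _).2
      ⟨none, some i, (starOption_adj_none _).2 (Option.some_ne_none i), rfl, rfl⟩)
  have heq := Set.eq_of_subset_of_ncard_le hsub (by
    have hinj : Function.Injective fun i => ι (some i) :=
      ι.injective.comp (Option.some_injective _)
    rw [← Set.image_univ, Set.ncard_image_of_injective _ hinj, Set.ncard_univ,
      Nat.card_eq_fintype_card, Fintype.card_fin]
    exact hdeg.le) (Set.toFinite _)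
  have : v ∈ Set.range fun i => ι (some i) := heq ▸ hv
  exact this

open scoped Classical in
/-- Each center of a star component belongs to at most `m ^ m` placements of the star, since such a
placement assigns to each leaf one of the `m` neighbours of the center. -/
lemma sum_star_le (m : ℕ) (G : SimpleGraph V) :
    ∑ ι : Option (Fin m) ↪ V, (if (starOption m).map ι ≤ G then
        ∏ q, (if G.ndeg (ι q) = starDegree m q then (1 : ℝ) else 0) else 0) ≤
      (m : ℝ) ^ m * (starCenters m G).card := by
  have h1 : ∀ ι : Option (Fin m) ↪ V, (if (starOption m).map ι ≤ G then
      ∏ q, (if G.ndeg (ι q) = starDegree m q then (1 : ℝ) else 0) else 0) =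
      if (starOption m).map ι ≤ G ∧ ∀ q, G.ndeg (ι q) = starDegree m q then 1 else 0 := by
    intro ι
    rw [Finset.prod_ite_zero]
    by_cases h : (starOption m).map ι ≤ G
    · by_cases h' : ∀ q, G.ndeg (ι q) = starDegree m q
      · rw [if_pos h, if_pos fun q _ => h' q, if_pos ⟨h, h'⟩, Finset.prod_const_one]
      · rw [if_pos h, if_neg fun h'' => h' fun q => h'' q (Finset.mem_univ q),
          if_neg fun h'' => h' h''.2]
    · rw [if_neg h, if_neg fun h'' => h h''.1]
  simp only [h1]
  rw [← Finset.sum_filter, Finset.sum_const, nsmul_eq_mul, mul_one]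
  have h2 : ((starCenters m G).sigma fun o =>
      Fintype.piFinset fun _ : Fin m => G.neighborFinset o).card =
      m ^ m * (starCenters m G).card := by
    rw [Finset.card_sigma, Finset.sum_congr rfl (g := fun _ => m ^ m), Finset.sum_const,
      smul_eq_mul, mul_comm]
    intro o ho
    rw [Fintype.card_piFinset_const, SimpleGraph.card_neighborFinset_eq_degree,
      ← ndeg_eq_degree, (Finset.mem_filter.1 ho).2.1]
  rw [← Nat.cast_pow, ← Nat.cast_mul, ← h2]
  norm_cast
  refine Finset.card_le_card_of_injOn (fun ι => ⟨ι none, fun i => ι (some i)⟩) ?_ ?_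
  · intro ι hι
    obtain ⟨h3, h4⟩ := (Finset.mem_filter.1 hι).2
    rw [Finset.mem_coe, Finset.mem_sigma]
    refine ⟨Finset.mem_filter.2 ⟨Finset.mem_univ _, h4 none, fun v hv => ?_⟩,
      Fintype.mem_piFinset.2 fun i => ?_⟩
    · obtain ⟨i, rfl⟩ := exists_eq_some_of_adj h3 (h4 none) hv
      exact h4 (some i)
    · rw [SimpleGraph.mem_neighborFinset]
      exact h3 ((SimpleGraph.map_adj _ _ _ _).2
        ⟨none, some i, (starOption_adj_none _).2 (Option.some_ne_none i), rfl, rfl⟩)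
  · intro ι _ ι' _ h
    simp only [Sigma.mk.injEq, heq_eq_eq] at h
    ext q
    cases q with
    | none => exact h.1
    | some i => exact congrFun h.2 i

/-- The square of the largest eigenvalue of `K` on a star with `m` leaves. -/
noncomputable def starEigenvalueSq (c : ℝ) (m : ℕ) : ℝ := m / ((c + m) * (c + 1))

variable [DecidableEq V]

lemma kMatrix_sq_apply_starCenter {c : ℝ} {m : ℕ} (hm : m ≠ 0) {G : SimpleGraph V} {o : V}
    (ho : o ∈ starCenters m G) : (kMatrix c G ^ 2) o o = starEigenvalueSq c m := by
  classical
  obtain ⟨h1, h2⟩ := (Finset.mem_filter.1 ho).2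
  rw [sq, Matrix.mul_apply]
  have h3 : ∀ u, kMatrix c G o u * kMatrix c G u o =
      if G.Adj o u then (c + m)⁻¹ * (c + 1)⁻¹ else 0 := by
    intro u
    rw [kMatrix_apply, kMatrix_apply]
    by_cases h : G.Adj o u
    · rw [if_pos h, if_pos h.symm, if_pos h, h1, h2 u h]
      simp [vertexWeight, hm]
    · rw [if_neg h, if_neg h, zero_mul]
  simp only [h3]
  rw [← Finset.sum_filter, Finset.sum_const, nsmul_eq_mul,
    ← SimpleGraph.neighborFinset_eq_filter, SimpleGraph.card_neighborFinset_eq_degree,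
    ← ndeg_eq_degree, h1, starEigenvalueSq, ← mul_inv, div_eq_mul_inv]

lemma IsSubstochastic.pow_apply_self_le {M : Matrix V V ℝ} (hM : IsSubstochastic M) (o : V)
    (i : ℕ) : M o o ^ i ≤ (M ^ i) o o := by
  induction i with
  | zero => simp
  | succ i ih =>
    rw [pow_succ, pow_succ, Matrix.mul_apply]
    calc M o o ^ i * M o o ≤ (M ^ i) o o * M o o := mul_le_mul_of_nonneg_right ih (hM.1 _ _)
      _ ≤ ∑ u, (M ^ i) o u * M u o :=
        Finset.single_le_sum (f := fun u => (M ^ i) o u * M u o)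
          (fun u _ => mul_nonneg ((hM.pow i).1 _ _) (hM.1 _ _)) (Finset.mem_univ o)

/-- The return weights of a nonnegative matrix with `(M ^ 2) o o = l ^ 2` dominate those of a
symmetric two-point distribution on `{l, -l}`. -/
lemma IsSubstochastic.le_one_add_pow_apply {M : Matrix V V ℝ} (hM : IsSubstochastic M) {o : V}
    {l : ℝ} (hl1 : l ≤ 1) (ho : (M ^ 2) o o = l ^ 2) (k : ℕ) :
    (1 + l) ^ k / 2 ≤ ((1 + M) ^ k) o o := by
  have h1 : ∀ j, (l ^ j + (-l) ^ j) / 2 ≤ (M ^ j) o o := by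
    intro j
    rcases Nat.even_or_odd' j with ⟨i, rfl | rfl⟩
    · rw [(even_two_mul i).neg_pow, pow_mul, pow_mul, ← ho]
      linarith [(hM.pow 2).pow_apply_self_le o i]
    · rw [(odd_two_mul_add_one i).neg_pow, add_neg_cancel, zero_div]
      exact (hM.pow _).1 _ _
  have h2 : ((1 + M) ^ k) o o = ∑ j ∈ Finset.range (k + 1), (k.choose j : ℝ) * (M ^ j) o o := by
    rw [add_comm, (Commute.one_right M).add_pow, Matrix.sum_apply]
    refine Finset.sum_congr rfl fun j _ => ?_
    rw [one_pow, mul_one, ← nsmul_eq_mul', Matrix.smul_apply, nsmul_eq_mul]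
  rw [h2]
  calc (1 + l) ^ k / 2 ≤ ((l + 1) ^ k + (-l + 1) ^ k) / 2 := by
        have : 0 ≤ (-l + 1) ^ k := pow_nonneg (by linarith) k
        rw [add_comm 1 l]
        linarith
    _ = ∑ j ∈ Finset.range (k + 1), (k.choose j : ℝ) * ((l ^ j + (-l) ^ j) / 2) := by
        rw [add_pow, add_pow, ← Finset.sum_add_distrib, Finset.sum_div]
        exact Finset.sum_congr rfl fun j _ => by ring
    _ ≤ _ := Finset.sum_le_sum fun j _ => mul_le_mul_of_nonneg_left (h1 j) (Nat.cast_nonneg _)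

end Star

lemma starEigenvalueSq_nonneg {c : ℝ} (hc : 0 ≤ c) (m : ℕ) : 0 ≤ starEigenvalueSq c m := by
  unfold starEigenvalueSq
  positivity

lemma starEigenvalueSq_le_one {c : ℝ} (hc : 0 ≤ c) (m : ℕ) : starEigenvalueSq c m ≤ 1 := by
  unfold starEigenvalueSq
  refine div_le_one_of_le₀ ?_ (by positivity)
  have : (0 : ℝ) ≤ m := Nat.cast_nonneg m
  nlinarith [mul_nonneg hc this, mul_nonneg hc hc]

lemma tendsto_sqrt_starEigenvalueSq (c : ℝ) :
    Tendsto (fun m : ℕ => √(starEigenvalueSq c m)) atTop (𝓝 (tau c)) := by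
  have h1 : Tendsto (fun m : ℕ => (m : ℝ) / (m + c)) atTop (𝓝 1) :=
    tendsto_natCast_div_add_atTop c
  have h2 : Tendsto (fun m : ℕ => starEigenvalueSq c m) atTop (𝓝 (1 / (1 + c))) := by
    refine (h1.div_const (1 + c)).congr fun m => ?_
    rw [starEigenvalueSq, div_div, add_comm c, add_comm c]
  have h3 := (Real.continuous_sqrt.tendsto _).comp h2
  rwa [Real.sqrt_div zero_le_one, Real.sqrt_one] at h3

/-- Star components contribute to the moments of `1 + K` at the exponential rate given by the
largest eigenvalue of a star. -/
lemma exists_le_mean_trace_one_add_pow {c p : ℝ} (hc : 0 ≤ c) (hp : 0 < p) {m : ℕ} (hm : m ≠ 0) :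
    ∃ δ : ℝ, 0 < δ ∧ ∀ k : ℕ, ∀ᶠ n : ℕ in atTop,
      δ * (1 + √(starEigenvalueSq c m)) ^ k ≤ (n : ℝ)⁻¹ * graphMean (p / n)
        (fun G : SimpleGraph (Fin n) => ((1 + kMatrix c G) ^ k).trace) := by
  classical
  obtain ⟨δ, hδ, hlim⟩ := exists_tendsto_mean_star hp m
  set l := √(starEigenvalueSq c m)
  have hl0 : 0 ≤ l := Real.sqrt_nonneg _
  have hl1 : l ≤ 1 := Real.sqrt_le_one.2 (starEigenvalueSq_le_one hc m)
  have hl2 : starEigenvalueSq c m = l ^ 2 := (Real.sq_sqrt (starEigenvalueSq_nonneg hc m)).symm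
  have hm0 : (0 : ℝ) < (m : ℝ) ^ m := pow_pos (by exact_mod_cast Nat.pos_of_ne_zero hm) _
  refine ⟨δ / 2 / (m : ℝ) ^ m / 2, by positivity, fun k => ?_⟩
  filter_upwards [eventually_div_mem_unitInterval hp,
    hlim.eventually (lt_mem_nhds (half_lt_self hδ))] with n hn hδn
  rw [← graphMean_sum] at hδn
  have hstar : ∀ G : SimpleGraph (Fin n),
      ((starCenters m G).card : ℝ) * ((1 + l) ^ k / 2) ≤ ((1 + kMatrix c G) ^ k).trace := by
    intro G
    have hK := isSubstochastic_kMatrix hc G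
    have hnn : ∀ o, 0 ≤ ((1 + kMatrix c G) ^ k) o o := by
      have : ∀ (k : ℕ) (i j : Fin n), 0 ≤ ((1 + kMatrix c G) ^ k) i j := by
        intro k
        induction k with
        | zero => simpa using IsSubstochastic.one.1
        | succ k ih =>
          intro i j
          rw [pow_succ, Matrix.mul_apply]
          exact Finset.sum_nonneg fun u _ => mul_nonneg (ih _ _)
            (add_nonneg (IsSubstochastic.one.1 _ _) (hK.1 _ _))
      exact fun o => this k o o
    calc ((starCenters m G).card : ℝ) * ((1 + l) ^ k / 2)
        = ∑ _o ∈ starCenters m G, (1 + l) ^ k / 2 := by rw [Finset.sum_const, nsmul_eq_mul]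
      _ ≤ ∑ o ∈ starCenters m G, ((1 + kMatrix c G) ^ k) o o :=
          Finset.sum_le_sum fun o ho => hK.le_one_add_pow_apply hl1
            ((kMatrix_sq_apply_starCenter hm ho).trans hl2) k
      _ ≤ ∑ o, ((1 + kMatrix c G) ^ k) o o :=
          Finset.sum_le_sum_of_subset_of_nonneg (Finset.subset_univ _) fun o _ _ => hnn o
      _ = _ := rfl
  have hmean := graphMean_mono hn.2.1 hn.2.2 (F' := fun G : SimpleGraph (Fin n) =>
    (m : ℝ) ^ m / ((1 + l) ^ k / 2) * ((1 + kMatrix c G) ^ k).trace)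
    (F := fun G => ∑ ι : Option (Fin m) ↪ Fin n, (if (starOption m).map ι ≤ G then
        ∏ q, (if G.ndeg (ι q) = starDegree m q then (1 : ℝ) else 0) else 0)) fun G => by
      refine (sum_star_le m G).trans ?_
      rw [div_mul_eq_mul_div, le_div_iff₀ (by positivity), mul_assoc]
      exact mul_le_mul_of_nonneg_left (hstar G) hm0.le
  rw [graphMean_const_mul] at hmean
  have h1 := hδn.le.trans (mul_le_mul_of_nonneg_left hmean (inv_nonneg.2 hn.1.le))
  rw [mul_left_comm, div_mul_eq_mul_div, le_div_iff₀ (by positivity)] at h1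
  rw [div_div, div_mul_eq_mul_div, div_le_iff₀ (by positivity)]
  linarith

/-! ### The limiting spectral distribution -/

section ESD

variable {n : ℕ} {c : ℝ}

lemma integral_esd_eq (hc : 0 ≤ c) (G : SimpleGraph (Fin n)) :
    ∃ e : Fin n → ℝ, (∀ f : ℝ → ℝ, ∫ x, f x ∂(esd (kMatrix c G)) = (n : ℝ)⁻¹ * ∑ i, f (e i)) ∧
      (∀ k, (kMatrix c G ^ k).trace = ∑ i, e i ^ k) ∧ ∀ i, |e i| ≤ 1 := by
  obtain ⟨e, he, htr, h1⟩ := exists_esd_kMatrix_eq hc G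
  refine ⟨e, fun f => ?_, htr, h1⟩
  rw [he, integral_smul_measure, integral_finsetSum_measure fun i _ => integrable_dirac (by simp)]
  simp

lemma isProbabilityMeasure_esd (hc : 0 ≤ c) (hn : n ≠ 0) (G : SimpleGraph (Fin n)) :
    IsProbabilityMeasure (esd (kMatrix c G)) := by
  obtain ⟨e, he, -, -⟩ := exists_esd_kMatrix_eq hc G
  constructor
  rw [he, Measure.smul_apply, Measure.finsetSum_apply]
  simp only [measure_univ, Finset.sum_const, Finset.card_univ, Fintype.card_fin, nsmul_eq_mul,
    mul_one, smul_eq_mul]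
  exact ENNReal.inv_mul_cancel (by exact_mod_cast hn) (ENNReal.natCast_ne_top n)

lemma esd_compl_Icc (hc : 0 ≤ c) (G : SimpleGraph (Fin n)) :
    esd (kMatrix c G) (Set.Icc (-1) 1)ᶜ = 0 := by
  obtain ⟨e, he, -, h1⟩ := exists_esd_kMatrix_eq hc G
  rw [he, Measure.smul_apply, Measure.finsetSum_apply, Finset.sum_eq_zero, smul_zero]
  intro i _
  rw [Measure.dirac_apply' _ measurableSet_Icc.compl, Set.indicator_of_notMem]
  exact fun h => h (abs_le.1 (h1 i))

lemma integral_pow_esd (hc : 0 ≤ c) (G : SimpleGraph (Fin n)) (k : ℕ) :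
    ∫ x, x ^ k ∂(esd (kMatrix c G)) = (n : ℝ)⁻¹ * (kMatrix c G ^ k).trace := by
  obtain ⟨e, he, htr, -⟩ := integral_esd_eq hc G
  rw [he, htr]

lemma integral_eval_esd (hc : 0 ≤ c) (G : SimpleGraph (Fin n)) (q : Polynomial ℝ) :
    ∫ x, q.eval x ∂(esd (kMatrix c G)) =
      (n : ℝ)⁻¹ * ∑ j ∈ Finset.range (q.natDegree + 1),
        q.coeff j * (kMatrix c G ^ j).trace := by
  obtain ⟨e, he, htr, -⟩ := integral_esd_eq hc G
  rw [he]
  simp only [htr, Polynomial.eval_eq_sum_range, Finset.mul_sum]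
  rw [Finset.sum_comm]

lemma integral_eval_esd_eq_trace (hc : 0 ≤ c) (G : SimpleGraph (Fin n)) (q : Polynomial ℝ) :
    ∫ x, q.eval x ∂(esd (kMatrix c G)) =
      (n : ℝ)⁻¹ * (Polynomial.aeval (kMatrix c G) q).trace := by
  rw [integral_eval_esd hc, Polynomial.aeval_eq_sum_range, Matrix.trace_sum]
  simp only [Matrix.trace_smul, smul_eq_mul]

/-- The mean of the empirical spectral distribution over the random graph. -/
noncomputable def meanESD (c p : ℝ) (n : ℕ) : Measure ℝ :=
  ∑ t ∈ (⊤ : SimpleGraph (Fin n)).edgeFinset.powerset,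
    ENNReal.ofReal (p ^ t.card * (1 - p) ^ ((⊤ : SimpleGraph (Fin n)).edgeFinset.card - t.card)) •
      esd (kMatrix c (SimpleGraph.fromEdgeSet (t : Set (Sym2 (Fin n)))))

variable {p : ℝ}

lemma isProbabilityMeasure_meanESD (hc : 0 ≤ c) (hn : n ≠ 0) (hp0 : 0 ≤ p) (hp1 : p ≤ 1) :
    IsProbabilityMeasure (meanESD c p n) := by
  constructor
  have h1 : ∀ t : Finset (Sym2 (Fin n)),
      esd (kMatrix c (SimpleGraph.fromEdgeSet (t : Set (Sym2 (Fin n))))) Set.univ = 1 := fun t =>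
    (isProbabilityMeasure_esd hc hn _).measure_univ
  rw [meanESD, Measure.finsetSum_apply]
  simp only [Measure.smul_apply, h1, smul_eq_mul, mul_one]
  rw [← ENNReal.ofReal_sum_of_nonneg fun t _ =>
    mul_nonneg (pow_nonneg hp0 _) (pow_nonneg (sub_nonneg.2 hp1) _), ← ENNReal.ofReal_one]
  congr 1
  simpa [bernoulliMean] using bernoulliMean_const (p := p)
    (s := (⊤ : SimpleGraph (Fin n)).edgeFinset) 1

lemma meanESD_compl_Icc (hc : 0 ≤ c) : meanESD c p n (Set.Icc (-1) 1)ᶜ = 0 := by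
  rw [meanESD, Measure.finsetSum_apply]
  exact Finset.sum_eq_zero fun t _ => by
    rw [Measure.smul_apply, esd_compl_Icc hc, smul_zero]

lemma integral_meanESD (hc : 0 ≤ c) (hn : n ≠ 0) (hp0 : 0 ≤ p) (hp1 : p ≤ 1) (f : ℝ →ᵇ ℝ) :
    ∫ x, f x ∂(meanESD c p n) =
      graphMean p fun G : SimpleGraph (Fin n) => ∫ x, f x ∂(esd (kMatrix c G)) := by
  rw [meanESD, integral_finsetSum_measure]
  · refine Finset.sum_congr rfl fun t _ => ?_
    rw [integral_smul_measure, ENNReal.toReal_ofReal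
      (mul_nonneg (pow_nonneg hp0 _) (pow_nonneg (sub_nonneg.2 hp1) _)), smul_eq_mul]
  · intro t _
    have := isProbabilityMeasure_esd hc hn (SimpleGraph.fromEdgeSet (t : Set (Sym2 (Fin n))))
    exact (f.integrable _).smul_measure ENNReal.ofReal_ne_top

end ESD

/-- A bounded continuous function that agrees with the `k`-th power on `[-1, 1]`. -/
noncomputable def clampPow (k : ℕ) : ℝ →ᵇ ℝ :=
  BoundedContinuousFunction.ofNormedAddCommGroup (fun x => (max (-1) (min 1 x)) ^ k)
    (by fun_prop) 1 fun x => by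
      rw [norm_pow]
      refine pow_le_one₀ (norm_nonneg _) ?_
      rw [Real.norm_eq_abs, abs_le]
      exact ⟨le_max_left _ _, max_le (by norm_num) (min_le_left _ _)⟩

lemma clampPow_apply {k : ℕ} {x : ℝ} (hx : x ∈ Set.Icc (-1 : ℝ) 1) : clampPow k x = x ^ k := by
  change (max (-1) (min 1 x)) ^ k = x ^ k
  rw [min_eq_right hx.2, max_eq_right hx.1]

lemma ae_mem_Icc {μ : Measure ℝ} (h : μ (Set.Icc (-1) 1)ᶜ = 0) :
    ∀ᵐ x ∂μ, x ∈ Set.Icc (-1 : ℝ) 1 := h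

lemma integral_clampPow {μ : Measure ℝ} (h : μ (Set.Icc (-1) 1)ᶜ = 0) (k : ℕ) :
    ∫ x, clampPow k x ∂μ = ∫ x, x ^ k ∂μ :=
  integral_congr_ae ((ae_mem_Icc h).mono fun _ hx => clampPow_apply hx)

lemma integrable_of_continuous_of_compl_Icc {μ : Measure ℝ} [IsFiniteMeasure μ]
    (h : μ (Set.Icc (-1) 1)ᶜ = 0) {f : ℝ → ℝ} (hf : Continuous f) : Integrable f μ := by
  obtain ⟨C, hC⟩ := (isCompact_Icc (a := (-1 : ℝ)) (b := 1)).exists_bound_of_continuousOn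
    hf.continuousOn
  exact Integrable.of_bound hf.aestronglyMeasurable C ((ae_mem_Icc h).mono hC)

/-- The moment problem for the limits of the mean normalized traces is solvable: a cluster point of
the mean empirical spectral distributions has these moments. -/
lemma exists_measure_of_moments {c p : ℝ} (hc : 0 ≤ c) (hp : 0 < p) {m : ℕ → ℝ}
    (hm : ∀ k, Tendsto (fun n : ℕ => (n : ℝ)⁻¹ * graphMean (p / n)
      (fun G : SimpleGraph (Fin n) => (kMatrix c G ^ k).trace)) atTop (𝓝 (m k))) :
    ∃ ν : ProbabilityMeasure ℝ, (ν : Measure ℝ) (Set.Icc (-1) 1)ᶜ = 0 ∧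
      ∀ k, ∫ x, x ^ k ∂(ν : Measure ℝ) = m k := by
  classical
  have hprob : ∀ᶠ n : ℕ in atTop, IsProbabilityMeasure (meanESD c (p / n) n) := by
    filter_upwards [eventually_div_mem_unitInterval hp] with n hn
    exact isProbabilityMeasure_meanESD hc (by rintro rfl; simp at hn) hn.2.1 hn.2.2
  set M : ℕ → ProbabilityMeasure ℝ := fun n =>
    if h : IsProbabilityMeasure (meanESD c (p / n) n) then ⟨meanESD c (p / n) n, h⟩
    else ⟨Measure.dirac 0, inferInstance⟩ with hM
  have hMeq : ∀ᶠ n : ℕ in atTop, (M n : Measure ℝ) = meanESD c (p / n) n := by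
    filter_upwards [hprob] with n hn
    have : M n = ⟨meanESD c (p / n) n, hn⟩ := dif_pos hn
    rw [this]
    rfl
  have hcomp := isCompact_setOfPred_probabilityMeasure_mass_eq_compl_isCompact_le
    (E := ℝ) (u := fun _ => 0) (K := fun _ => Set.Icc (-1 : ℝ) 1) tendsto_const_nhds
    (fun _ => isCompact_Icc) (Or.inl inferInstance)
  -- compactness provides a limit along an ultrafilter, and all moments converge along it
  set 𝒰 : Ultrafilter ℕ := Ultrafilter.of atTop
  have h𝒰 : (𝒰 : Filter ℕ) ≤ atTop := Ultrafilter.of_le atTop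
  obtain ⟨ν, hν, hlim⟩ := hcomp.ultrafilter_le_nhds' (𝒰.map M) (by
    refine h𝒰 ?_
    filter_upwards [hMeq] with n hn k
    have : (M n : Measure ℝ) (Set.Icc (-1) 1)ᶜ = 0 := by rw [hn, meanESD_compl_Icc hc]
    rw [nonpos_iff_eq_zero, ProbabilityMeasure.null_iff_toMeasure_null]
    exact this)
  have hν0 : (ν : Measure ℝ) (Set.Icc (-1) 1)ᶜ = 0 := by
    have := hν 0
    rwa [nonpos_iff_eq_zero, ProbabilityMeasure.null_iff_toMeasure_null] at this
  refine ⟨ν, hν0, fun k => ?_⟩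
  have h1 := ProbabilityMeasure.tendsto_iff_forall_integral_tendsto.1
    (show Tendsto M 𝒰 (𝓝 ν) from hlim) (clampPow k)
  have h2 : Tendsto (fun n => ∫ x, clampPow k x ∂(M n : Measure ℝ)) 𝒰 (𝓝 (m k)) := by
    refine ((hm k).congr' ?_).mono_left h𝒰
    filter_upwards [hMeq, eventually_div_mem_unitInterval hp] with n hn hpn
    rw [hn, integral_meanESD hc (by rintro rfl; simp at hpn) hpn.2.1 hpn.2.2,
      ← graphMean_const_mul]
    refine graphMean_congr fun G => ?_
    rw [integral_clampPow (esd_compl_Icc hc G), integral_pow_esd hc]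
  rw [← integral_clampPow hν0]
  exact tendsto_nhds_unique h1 h2

section Convergence

variable {c p : ℝ} {ν : ProbabilityMeasure ℝ}

lemma integral_eval_eq_sum (hν : (ν : Measure ℝ) (Set.Icc (-1) 1)ᶜ = 0) (q : Polynomial ℝ) :
    ∫ x, q.eval x ∂(ν : Measure ℝ) =
      ∑ j ∈ Finset.range (q.natDegree + 1), q.coeff j * ∫ x, x ^ j ∂(ν : Measure ℝ) := by
  simp only [Polynomial.eval_eq_sum_range]
  rw [integral_finsetSum _ fun j _ => integrable_of_continuous_of_compl_Icc hν (by fun_prop)]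
  exact Finset.sum_congr rfl fun j _ => integral_const_mul _ _

lemma tendsto_mean_integral_eval_esd (hc : 0 ≤ c)
    (hν : (ν : Measure ℝ) (Set.Icc (-1) 1)ᶜ = 0)
    (hm : ∀ k, Tendsto (fun n : ℕ => (n : ℝ)⁻¹ * graphMean (p / n)
      (fun G : SimpleGraph (Fin n) => (kMatrix c G ^ k).trace)) atTop
        (𝓝 (∫ x, x ^ k ∂(ν : Measure ℝ)))) (q : Polynomial ℝ) :
    Tendsto (fun n : ℕ => graphMean (p / n) fun G : SimpleGraph (Fin n) =>
      ∫ x, q.eval x ∂(esd (kMatrix c G))) atTop (𝓝 (∫ x, q.eval x ∂(ν : Measure ℝ))) := by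
  rw [integral_eval_eq_sum hν]
  refine (tendsto_finsetSum _ fun j _ => (hm j).const_mul (q.coeff j)).congr fun n => ?_
  simp only [integral_eval_esd hc, graphMean_const_mul, graphMean_sum, Finset.mul_sum]
  exact Finset.sum_congr rfl fun j _ => by ring

/-- Adding one edge has an effect of order `1 / n` on linear statistics of the spectrum, so that
their variance is of order `1 / n` by the Efron–Stein inequality. -/
lemma variance_integral_eval_esd_le (hc : 0 ≤ c) (q : Polynomial ℝ) {n : ℕ}
    (hn : 0 < (n : ℝ) ∧ 0 ≤ p / n ∧ p / n ≤ 1) :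
    graphMean (p / n) (fun G : SimpleGraph (Fin n) => (∫ x, q.eval x ∂(esd (kMatrix c G))) ^ 2) -
      graphMean (p / n) (fun G : SimpleGraph (Fin n) => ∫ x, q.eval x ∂(esd (kMatrix c G))) ^ 2 ≤
      (∑ j ∈ Finset.range (q.natDegree + 1), |q.coeff j| * (4 * j)) ^ 2 * (p / n) := by
  set C := ∑ j ∈ Finset.range (q.natDegree + 1), |q.coeff j| * (4 * j) with hC
  have h1 := bernoulliMean_variance_le (s := (⊤ : SimpleGraph (Fin n)).edgeFinset)
    (f := fun t => ∫ x, q.eval x ∂(esd (kMatrix c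
      (SimpleGraph.fromEdgeSet (t : Set (Sym2 (Fin n))))))) (C := (n : ℝ)⁻¹ * C) hn.2.1 hn.2.2
    fun e _ t _ _ => by
      rw [integral_eval_esd hc, integral_eval_esd hc, ← mul_sub, abs_mul,
        abs_of_nonneg (inv_nonneg.2 hn.1.le), ← Finset.sum_sub_distrib]
      refine mul_le_mul_of_nonneg_left ?_ (inv_nonneg.2 hn.1.le)
      refine (Finset.abs_sum_le_sum_abs _ _).trans (Finset.sum_le_sum fun j _ => ?_)
      rw [← mul_sub, abs_mul]
      exact mul_le_mul_of_nonneg_left (abs_trace_kMatrix_pow_sub_le hc t e j) (abs_nonneg _)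
  refine h1.trans ?_
  have hcard : ((⊤ : SimpleGraph (Fin n)).edgeFinset.card : ℝ) ≤ (n : ℝ) ^ 2 := by
    rw [SimpleGraph.card_edgeFinset_top_eq_card_choose_two, Fintype.card_fin]
    exact_mod_cast Nat.choose_le_pow n 2
  have hpp : p / n * (1 - p / n) ≤ p / n :=
    mul_le_of_le_one_right hn.2.1 (by linarith [hn.2.1])
  have hpp0 : 0 ≤ p / n * (1 - p / n) := mul_nonneg hn.2.1 (by linarith [hn.2.2])
  calc _ ≤ (n : ℝ) ^ 2 * (p / n) * ((n : ℝ)⁻¹ * C) ^ 2 := by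
        refine mul_le_mul_of_nonneg_right ?_ (sq_nonneg _)
        exact mul_le_mul hcard hpp hpp0 (sq_nonneg _)
    _ = C ^ 2 * (p / n) := by
        have := hn.1.ne'
        field_simp

/-- The mean square error is the sum of the variance and the squared bias. -/
lemma tendsto_mean_sq_sub (hc : 0 ≤ c) (hp : 0 < p)
    (hν : (ν : Measure ℝ) (Set.Icc (-1) 1)ᶜ = 0)
    (hm : ∀ k, Tendsto (fun n : ℕ => (n : ℝ)⁻¹ * graphMean (p / n)
      (fun G : SimpleGraph (Fin n) => (kMatrix c G ^ k).trace)) atTop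
        (𝓝 (∫ x, x ^ k ∂(ν : Measure ℝ)))) (q : Polynomial ℝ) :
    Tendsto (fun n : ℕ => graphMean (p / n) fun G : SimpleGraph (Fin n) =>
      (∫ x, q.eval x ∂(esd (kMatrix c G)) - ∫ x, q.eval x ∂(ν : Measure ℝ)) ^ 2) atTop (𝓝 0) := by
  set L := ∫ x, q.eval x ∂(ν : Measure ℝ)
  have hexp : ∀ n : ℕ, graphMean (p / n) (fun G : SimpleGraph (Fin n) =>
      (∫ x, q.eval x ∂(esd (kMatrix c G)) - L) ^ 2) =
      (graphMean (p / n) (fun G : SimpleGraph (Fin n) =>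
        (∫ x, q.eval x ∂(esd (kMatrix c G))) ^ 2) -
      graphMean (p / n) (fun G : SimpleGraph (Fin n) =>
        ∫ x, q.eval x ∂(esd (kMatrix c G))) ^ 2) +
      (graphMean (p / n) (fun G : SimpleGraph (Fin n) =>
        ∫ x, q.eval x ∂(esd (kMatrix c G))) - L) ^ 2 := by
    intro n
    have : ∀ G : SimpleGraph (Fin n), (∫ x, q.eval x ∂(esd (kMatrix c G)) - L) ^ 2 =
        ((∫ x, q.eval x ∂(esd (kMatrix c G))) ^ 2 + L ^ 2) -
          2 * L * ∫ x, q.eval x ∂(esd (kMatrix c G)) := fun G => by ring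
    rw [graphMean_congr this]
    simp only [graphMean, bernoulliMean_sub, bernoulliMean_add, bernoulliMean_const_mul,
      bernoulliMean_const]
    ring
  have hlim1 : Tendsto (fun n : ℕ =>
      (∑ j ∈ Finset.range (q.natDegree + 1), |q.coeff j| * (4 * j)) ^ 2 * (p / n) +
      (graphMean (p / n) (fun G : SimpleGraph (Fin n) =>
        ∫ x, q.eval x ∂(esd (kMatrix c G))) - L) ^ 2) atTop (𝓝 0) := by
    have h1 := (tendsto_const_div_atTop_nhds_zero_nat p).const_mul
      ((∑ j ∈ Finset.range (q.natDegree + 1), |q.coeff j| * (4 * j)) ^ 2)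
    have h2 := ((tendsto_mean_integral_eval_esd hc hν hm q).sub_const L).pow 2
    change Tendsto _ _ (𝓝 ((L - L) ^ 2)) at h2
    simpa using h1.add h2
  refine squeeze_zero' ?_ ?_ hlim1
  · filter_upwards [eventually_div_mem_unitInterval hp] with n hn
    exact bernoulliMean_nonneg hn.2.1 hn.2.2 fun _ _ => sq_nonneg _
  · filter_upwards [eventually_div_mem_unitInterval hp] with n hn
    rw [hexp]
    exact add_le_add_left (variance_integral_eval_esd_le hc q hn) _

/-- Convergence of the mean moments implies weak convergence in probability: a bounded continuous
function is uniformly close to a polynomial on `[-1, 1]`, and the integrals of polynomials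
concentrate. -/
lemma isLimitingESD_of_moments (hc : 0 ≤ c) (hp : 0 < p)
    (hν : (ν : Measure ℝ) (Set.Icc (-1) 1)ᶜ = 0)
    (hm : ∀ k, Tendsto (fun n : ℕ => (n : ℝ)⁻¹ * graphMean (p / n)
      (fun G : SimpleGraph (Fin n) => (kMatrix c G ^ k).trace)) atTop
        (𝓝 (∫ x, x ^ k ∂(ν : Measure ℝ)))) : IsLimitingESD c p ν := by
  classical
  intro f ε hε
  obtain ⟨q, hq⟩ := exists_polynomial_near_of_continuousOn (-1) 1 f f.continuous.continuousOn
    (ε / 4) (by positivity)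
  have hclose : ∀ μ : Measure ℝ, IsProbabilityMeasure μ → μ (Set.Icc (-1) 1)ᶜ = 0 →
      |∫ x, f x ∂μ - ∫ x, q.eval x ∂μ| ≤ ε / 4 := by
    intro μ hμ hμ0
    rw [← integral_sub (f.integrable μ)
      (integrable_of_continuous_of_compl_Icc hμ0 q.continuous)]
    have := norm_integral_le_of_norm_le_const (μ := μ) (f := fun x => f x - q.eval x)
      (C := ε / 4) ((ae_mem_Icc hμ0).mono fun x hx => by
        rw [Real.norm_eq_abs, abs_sub_comm]
        exact (hq x hx).le)
    simpa using this
  -- by Chebyshev's inequality for the polynomial `q`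
  have hlim := (tendsto_mean_sq_sub hc hp hν hm q).const_mul ((ε / 2) ^ 2)⁻¹
  rw [mul_zero] at hlim
  have hreal : Tendsto (fun n : ℕ => (SimpleGraph.binomialRandom (Fin n) (edgeProb p n)).real
      {G : SimpleGraph (Fin n) |
        ε ≤ |(∫ x, f x ∂(esd (kMatrix c G))) - ∫ x, f x ∂(ν : Measure ℝ)|}) atTop (𝓝 0) := by
    refine squeeze_zero' (Eventually.of_forall fun n => measureReal_nonneg) ?_ hlim
    filter_upwards [eventually_div_mem_unitInterval hp] with n hn
    have hedge : (edgeProb p n : ℝ) = p / n := by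
      rw [edgeProb, Set.projIcc_of_mem zero_le_one ⟨hn.2.1, hn.2.2⟩]
    rw [binomialRandom_real_setOf, hedge, ← graphMean_const_mul]
    refine graphMean_mono hn.2.1 hn.2.2 fun G => ?_
    split_ifs with hG
    · have hn0 : n ≠ 0 := by rintro rfl; simp at hn
      have h1 := hclose _ (isProbabilityMeasure_esd hc hn0 G) (esd_compl_Icc hc G)
      have h2 := hclose ν inferInstance hν
      have h3 : ε / 2 ≤ |∫ x, q.eval x ∂(esd (kMatrix c G)) -
          ∫ x, q.eval x ∂(ν : Measure ℝ)| := by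
        rw [abs_le] at h1 h2
        rcases le_abs.1 hG with h | h
        · exact le_abs.2 (Or.inl (by linarith))
        · exact le_abs.2 (Or.inr (by linarith))
      rw [inv_mul_eq_div, le_div_iff₀ (by positivity), one_mul, ← sq_abs (_ - _)]
      exact pow_le_pow_left₀ (by positivity) h3 2
    · positivity
  have := ENNReal.tendsto_ofReal hreal
  simpa only [measureReal_def, ENNReal.ofReal_toReal (measure_ne_top _ _),
    ENNReal.ofReal_zero] using this

end Convergence

lemma IsLimitingESD.unique {c p : ℝ} {μ ν : ProbabilityMeasure ℝ} (hμ : IsLimitingESD c p μ)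
    (hν : IsLimitingESD c p ν) : μ = ν := by
  suffices (μ : Measure ℝ) = ν from Subtype.ext this
  refine ext_of_forall_integral_eq_of_IsFiniteMeasure fun f => ?_
  by_contra hne
  set a := ∫ x, f x ∂(μ : Measure ℝ)
  set b := ∫ x, f x ∂(ν : Measure ℝ)
  have hpos : 0 < |a - b| / 2 := half_pos (abs_pos.2 (sub_ne_zero.2 hne))
  have h := (hμ f _ hpos).add (hν f _ hpos)
  rw [add_zero] at h
  -- every graph is at distance at least `|a - b| / 2` from one of the two limits
  have h1 : ∀ n : ℕ, (1 : ℝ≥0∞) ≤ SimpleGraph.binomialRandom (Fin n) (edgeProb p n)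
      {G : SimpleGraph (Fin n) | |a - b| / 2 ≤ |(∫ x, f x ∂(esd (kMatrix c G))) - a|} +
      SimpleGraph.binomialRandom (Fin n) (edgeProb p n)
      {G : SimpleGraph (Fin n) | |a - b| / 2 ≤ |(∫ x, f x ∂(esd (kMatrix c G))) - b|} := by
    intro n
    rw [← measure_univ (μ := SimpleGraph.binomialRandom (Fin n) (edgeProb p n))]
    refine (measure_mono fun G _ => ?_).trans (measure_union_le _ _)
    by_contra hG
    simp only [Set.mem_union, Set.mem_ofPred_eq, not_or, not_le] at hG
    have := abs_sub_le a (∫ x, f x ∂(esd (kMatrix c G))) b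
    rw [abs_sub_comm a (∫ x, f x ∂(esd (kMatrix c G)))] at this
    linarith [hG.1, hG.2]
  exact absurd (ge_of_tendsto' h h1) (by simp)

/-- If the moments of `ν` grow at most like `τ ^ k`, then `ν` does not charge `(x, ∞)` for
any `x > τ`. -/
lemma measure_Ioi_eq_zero_of_moments {ν : ProbabilityMeasure ℝ}
    (hν : (ν : Measure ℝ) (Set.Icc (-1) 1)ᶜ = 0) {τ x : ℝ} (hτ : 0 < τ)
    (hm : ∀ k, ∫ y, y ^ k ∂(ν : Measure ℝ) ≤ τ ^ k) (hx : τ < x) :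
    (ν : Measure ℝ) (Set.Ioi x) = 0 := by
  by_contra hne
  have hx0 : 0 < x := hτ.trans hx
  have hpos : 0 < (ν : Measure ℝ).real (Set.Ioi x) :=
    ENNReal.toReal_pos hne (measure_ne_top _ _)
  have h1 : ∀ k : ℕ, (ν : Measure ℝ).real (Set.Ioi x) ≤ (τ ^ 2 / x ^ 2) ^ k := by
    intro k
    have hint := integrable_of_continuous_of_compl_Icc hν (continuous_pow (M := ℝ) (2 * k))
    have h2 : x ^ (2 * k) * (ν : Measure ℝ).real {y | x ^ (2 * k) ≤ y ^ (2 * k)} ≤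
        ∫ y, y ^ (2 * k) ∂(ν : Measure ℝ) :=
      mul_meas_ge_le_integral_of_nonneg
        (Eventually.of_forall fun y => (even_two_mul k).pow_nonneg y) hint _
    have h3 : (ν : Measure ℝ).real (Set.Ioi x) ≤
        (ν : Measure ℝ).real {y | x ^ (2 * k) ≤ y ^ (2 * k)} :=
      measureReal_mono fun y hy => pow_le_pow_left₀ hx0.le (le_of_lt hy) _
    rw [div_pow, le_div_iff₀ (by positivity), ← pow_mul, ← pow_mul, mul_comm]
    exact (mul_le_mul_of_nonneg_left h3 (by positivity)).trans (h2.trans (hm _))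
  have h4 : Tendsto (fun k : ℕ => (τ ^ 2 / x ^ 2) ^ k) atTop (𝓝 0) := by
    refine tendsto_pow_atTop_nhds_zero_of_lt_one (by positivity) ?_
    rw [div_lt_one (by positivity)]
    exact pow_lt_pow_left₀ hx hτ.le two_ne_zero
  exact absurd (ge_of_tendsto' h4 h1) (not_le.2 hpos)

/-- If the moments of `1 + y` grow at least like `(1 + l) ^ k`, then `ν` charges `(x, ∞)` for
all `x < l`. -/
lemma measure_Ioi_pos_of_moments {ν : ProbabilityMeasure ℝ}
    (hν : (ν : Measure ℝ) (Set.Icc (-1) 1)ᶜ = 0) {δ l x : ℝ} (hδ : 0 < δ) (hx0 : 0 ≤ x)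
    (hm : ∀ k : ℕ, δ * (1 + l) ^ k ≤ ∫ y, (1 + y) ^ k ∂(ν : Measure ℝ)) (hx : x < l) :
    0 < (ν : Measure ℝ) (Set.Ioi x) := by
  by_contra hne
  have hzero : (ν : Measure ℝ) (Set.Ioi x) = 0 := by simpa using hne
  have hae : ∀ᵐ y ∂(ν : Measure ℝ), y ≤ x := by
    have : {y | ¬ y ≤ x} = Set.Ioi x := by ext; simp
    rw [ae_iff, this, hzero]
  have h1 : ∀ k : ℕ, δ ≤ ((1 + x) / (1 + l)) ^ k := by
    intro k
    have h2 : ∫ y, (1 + y) ^ k ∂(ν : Measure ℝ) ≤ (1 + x) ^ k := by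
      calc ∫ y, (1 + y) ^ k ∂(ν : Measure ℝ) ≤ ∫ _y, (1 + x) ^ k ∂(ν : Measure ℝ) := by
            refine integral_mono_ae (integrable_of_continuous_of_compl_Icc hν (by fun_prop))
              (integrable_const _) ?_
            filter_upwards [hae, ae_mem_Icc hν] with y hy hy1
            exact pow_le_pow_left₀ (by linarith [hy1.1]) (by linarith) k
        _ = (1 + x) ^ k := by simp
    have hl : 0 < 1 + l := by linarith
    rw [div_pow, le_div_iff₀ (pow_pos hl k)]
    exact (hm k).trans h2
  have h4 : Tendsto (fun k : ℕ => ((1 + x) / (1 + l)) ^ k) atTop (𝓝 0) := by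
    refine tendsto_pow_atTop_nhds_zero_of_lt_one (div_nonneg (by linarith) (by linarith)) ?_
    rw [div_lt_one (by linarith)]
    linarith
  exact absurd (ge_of_tendsto' h4 h1) (not_le.2 hδ)

theorem mainTheorem3 (c p : ℝ) (hc : 0 ≤ c) (hp : 0 < p) :
    ∃ ν : ProbabilityMeasure ℝ,
      IsLimitingESD c p ν ∧
      (∀ μ : ProbabilityMeasure ℝ, IsLimitingESD c p μ → μ = ν) ∧
      IsEssSup (ν : Measure ℝ) (tau c) := by
  choose m hm hmτ using exists_tendsto_mean_trace_pow hc hp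
  obtain ⟨ν, hν, hνm⟩ := exists_measure_of_moments hc hp hm
  simp only [← hνm] at hm hmτ
  have hlim := isLimitingESD_of_moments hc hp hν hm
  refine ⟨ν, hlim, fun μ hμ => hμ.unique hlim, ?_, ?_⟩
  · intro x hx
    by_contra! hlt
    exact (ne_of_gt hx) (measure_Ioi_eq_zero_of_moments hν (tau_pos hc) hmτ hlt)
  · intro b hb
    by_contra! hlt
    -- stars are taken so large that their top eigenvalue exceeds some `x > max b 0`
    have hb0 : max b 0 < tau c := max_lt hlt (tau_pos hc)
    obtain ⟨x, hbx, hxτ⟩ := exists_between hb0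
    obtain ⟨M, hxl, hM⟩ := (((tendsto_sqrt_starEigenvalueSq c).eventually
      (lt_mem_nhds hxτ)).and (eventually_ne_atTop 0)).exists
    obtain ⟨δ, hδ, hδk⟩ := exists_le_mean_trace_one_add_pow hc hp hM
    have hpos := measure_Ioi_pos_of_moments hν hδ ((le_max_right _ _).trans hbx.le)
      (fun k => by
        have hq := tendsto_mean_integral_eval_esd hc hν hm ((1 + Polynomial.X) ^ k)
        simp only [Polynomial.eval_pow, Polynomial.eval_add, Polynomial.eval_one,
          Polynomial.eval_X] at hq
        refine ge_of_tendsto hq ?_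
        filter_upwards [hδk k] with n hn
        refine hn.trans_eq ?_
        rw [← graphMean_const_mul]
        refine graphMean_congr fun G => ?_
        have := integral_eval_esd_eq_trace hc G ((1 + Polynomial.X) ^ k)
        simp only [Polynomial.eval_pow, Polynomial.eval_add, Polynomial.eval_one,
          Polynomial.eval_X, map_pow, map_add, map_one, Polynomial.aeval_X] at this
        exact this.symm) hxl
    exact absurd (hb hpos) (not_le.2 ((le_max_left _ _).trans_lt hbx))
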